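/- Let $n \ge 2$. Label the $6n^2$ stickers of the $n\times n\times n$ Rubik's Cube, and let $\mathbf G \le \mathbf S_{6n^2}$ be the group of all permutations of the stickers caused by sequences of slice rotations, that is, the group generated by the clockwise quarter turns of the $k$-th slice from each of the six faces, $1 \le k \le \lfloor n/2\rfloor$ (for odd $n$ the central slices are not rotated). The appearance of a configuration is the colouring of the $6n^2$ sticker places by the six colours that it shows. Let $\mathcal S_{\mathrm{phys}}$ be the set of physically distinct valid configurations, that is, of the appearances of the configurations reachable from the solved state by slice rotations. The group $\mathbf G$ acts on $\mathcal S_{\mathrm{phys}}$ from the left by moving the stickers. A center is a cubie with exactly one sticker. Call a permutation of the stickers an even center permutation if it fixes every sticker of every corner and edge cubie, and maps every $\mathbf G$-orbit of center stickers onto itself by an even permutation. Theorem. Let $s \in \mathcal S_{\mathrm{phys}}$, and let $\mathbf G_s = \{g \in \mathbf G : g\cdot s = s\}$ be its stabilizer. Then $\mathbf G_s$ consists exactly of the even center permutations that leave the appearance $s$ unchanged (in particular, every such permutation is valid, i.e. lies in $\mathbf G$). Moreover, $$|\mathbf G_s| = \left(\frac{24^6}{2}\right)^{\frac{(n-3)(n-1)}{4}}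 \text{ if } n \text{ is odd}, \qquad |\mathbf G_s| = \left(\frac{24^6}{2}\right)^{\frac{(n-2)^2}{4}} \text{ if } n \text{ is even}.$$ -/

import Mathlib

namespace Rubik

/-- The six faces of the cube, `(a, true)` being the face perpendicular to the coordinate axis `a`
on its positive side and `(a, false)` the one on its negative side. A face also serves as the name
of the colour that it shows in the solved state. -/
abbrev Face : Type := Fin 3 × Bool

/-- The `6 n ^ 2` stickers (more precisely, sticker places). The cubies are addressed by integer
coordinates in `{0, …, n - 1} ^ 3`. The sticker `((a, s), u, v)` lies on the face `(a, s)`, on the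
cubie whose coordinate on the axis `a + 1` is `u` and whose coordinate on the axis `a + 2` is `v`
(the axes are numbered modulo 3, and the frame `(a, a + 1, a + 2)` is right-handed). -/
abbrev Sticker (n : ℕ) : Type := Face × Fin n × Fin n

/-- The cubie that carries a sticker, given by its three coordinates. -/
def cubie {n : ℕ} (x : Sticker n) : Fin 3 → ℕ := fun b =>
  if b = x.1.1 then (if x.1.2 then n - 1 else 0)
  else if b = x.1.1 + 1 then (x.2.1 : ℕ) else (x.2.2 : ℕ)

/-- The rotation of the whole cube by a quarter turn about the axis `a`, counterclockwise as seen
from the positive side of `a`. It maps the direction `a + 1` to `a + 2` and `a + 2` to minus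
`a + 1`, so it maps the cubie with coordinates `(p, q, r)` on the axes `(a, a + 1, a + 2)` to the
one with coordinates `(p, n - 1 - r, q)`. -/
def rot (n : ℕ) (a : Fin 3) : Equiv.Perm (Sticker n) where
  toFun x :=
    if x.1.1 = a then ((a, x.1.2), x.2.2.rev, x.2.1)
    else if x.1.1 = a + 1 then ((a + 2, x.1.2), x.2.2, x.2.1.rev)
    else ((a + 1, !x.1.2), x.2.2, x.2.1)
  invFun x :=
    if x.1.1 = a then ((a, x.1.2), x.2.2, x.2.1.rev)
    else if x.1.1 = a + 1 then ((a + 2, !x.1.2), x.2.2, x.2.1)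
    else ((a + 1, x.1.2), x.2.2.rev, x.2.1)
  left_inv := by
    rintro ⟨⟨b, s⟩, u, v⟩
    fin_cases a <;> fin_cases b <;> simp
  right_inv := by
    rintro ⟨⟨b, s⟩, u, v⟩
    fin_cases a <;> fin_cases b <;> simp

theorem cubie_rot {n : ℕ} (a : Fin 3) (x : Sticker n) : cubie (rot n a x) a = cubie x a := by
  obtain ⟨⟨b, s⟩, u, v⟩ := x
  fin_cases a <;> fin_cases b <;> simp [cubie, rot]

/-- The same quarter turn, applied only to the slice of the cubies whose coordinate on the axis `a`
is `c`; all other stickers stay in place. -/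
def sliceRot (n : ℕ) (a : Fin 3) (c : ℕ) : Equiv.Perm (Sticker n) :=
  Equiv.Perm.ofSubtype
    ((rot n a).subtypePerm (p := fun x => cubie x a = c) (fun x => by rw [cubie_rot]))

/-- The clockwise quarter turn, as seen from outside the face `f`, of the `k`-th slice counted from
the face `f`. -/
def turn (n : ℕ) (f : Face) (k : ℕ) : Equiv.Perm (Sticker n) :=
  if f.2 then (sliceRot n f.1 (n - k))⁻¹ else sliceRot n f.1 (k - 1)

/-- The group of the `n × n × n` Rubik's Cube: all permutations of the stickers that are caused by
sequences of slice rotations. For odd `n` the central slices are not rotated. -/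
def G (n : ℕ) : Subgroup (Equiv.Perm (Sticker n)) :=
  Subgroup.closure {m | ∃ (f : Face) (k : ℕ), 1 ≤ k ∧ k ≤ n / 2 ∧ m = turn n f k}

/-- The appearance of a configuration `s`. The configuration `s` is a permutation of the stickers,
which has moved the sticker from the place `x` of the solved state to the place `s x`; the
appearance assigns to each place the colour of the sticker that is now there. -/
def appearance {n : ℕ} (s : Equiv.Perm (Sticker n)) : Sticker n → Face := fun x => (s⁻¹ x).1

/-- The physically distinct valid configurations: the appearances of the configurations that are
reached from the solved state by slice rotations. -/
def Sphys (n : ℕ) : Set (Sticker n → Face) := {c | ∃ s ∈ G n, appearance s = c}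

/-- The group acts on the left on the physically distinct valid configurations by moving the
stickers: the colour seen at `x` after `g` is the one that was seen at `g⁻¹ x`. In particular
`g • appearance s = appearance (g * s)`. -/
instance (n : ℕ) : MulAction (G n) (Sphys n) where
  smul g c := ⟨fun x => c.1 ((g : Equiv.Perm (Sticker n))⁻¹ x), by
    obtain ⟨s, hs, hc⟩ := c.2
    refine ⟨g * s, mul_mem g.2 hs, ?_⟩
    rw [← hc]
    funext x
    simp [appearance]⟩
  one_smul _ := rfl
  mul_smul _ _ _ := rfl

/-- A sticker is a center sticker if its cubie has no other sticker. -/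
def IsCenter {n : ℕ} (x : Sticker n) : Prop := ∀ y : Sticker n, cubie y = cubie x → y = x

open Classical in
/-- The permutation `g` maps the set `O` onto itself and is even as a permutation of `O`. -/
def IsEvenOn {n : ℕ} (g : Equiv.Perm (Sticker n)) (O : Set (Sticker n)) : Prop :=
  ∃ h : ∀ x, g x ∈ O ↔ x ∈ O, Equiv.Perm.sign (g.subtypePerm h) = 1

/-- An even center permutation: it fixes all stickers of corners and edges, and it maps every
orbit of center stickers under the cube group onto itself by an even permutation. -/
def IsEvenCenterPerm {n : ℕ} (g : Equiv.Perm (Sticker n)) : Prop :=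
  (∀ x, ¬ IsCenter x → g x = x) ∧ ∀ x, IsCenter x → IsEvenOn g (MulAction.orbit (G n) x)

end Rubik

/-!
Conjugating an element `g` of the stabilizer of an appearance by a configuration with this
appearance gives an element of the cube group that keeps every sticker on its face. Slice turns move
whole cubies and respect the orbits of the rotation group of the cube. A corner or edge cubie is
known from its faces up to the position along an edge, and the rotation orbit fixes this position
because rotations preserve handedness. So `g` fixes all corners and edges
(`apply_eq_of_not_isCenter`).

All rotation orbits except those of the middles of the faces are copies of the 24 stickers of the
`2 × 2 × 2` cube (`emb`). A quarter turn of the slice `c` splits on the orbit of the position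
`(u, v)` into as many 4-cycles as `c` occurs among `0, n - 1, u, n - 1 - u, v, n - 1 - v`. Hence the
sign on this orbit is the product of the signs on the corners, i.e. on the orbit of `(0, 0)`, and on
the orbits of `(0, u)` and `(0, v)`, which consist of edge (or corner) stickers (`exists_models`).
An element that fixes corners and edges is therefore even on each center orbit
(`sign_eq_one_of_fixes`).

Conversely, take an inner slice turn, conjugated by the turn of a slice about another axis. Its
support meets that of a face turn in one center sticker only, and the commutator of the two is a
3-cycle (`exists_threeCycle`). The conjugating slice may be the central one, since its turns
normalize the group (`sliceRot_mem_normalizer`); this is needed for stickers on the middle lines of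
the faces. Any sticker and its image under a generator lie on a common such 3-cycle, which makes the
group of the permutations of one orbit that are realized with all other stickers fixed primitive. By
Jordan's theorem it contains the alternating group (`viaEmbedding_mem_G`).

So the stabilizer is the product, over the center orbits, of the groups of even permutations of 24
points that preserve a colouring in which each of six colours occurs four times
(`card_even_stabilizer`). A pinwheel of four rectangles of `(n / 2 - 1) * ((n - 1) / 2)` positions
tiles the inner part of a face up to its middle, and counts these orbits.
-/

namespace Rubik

/-! ### Slices -/

theorem perm_apply_inv {α : Type*} (g : Equiv.Perm α) (x : α) : g (g⁻¹ x) = x :=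
  g.apply_symm_apply x

theorem perm_inv_apply {α : Type*} (g : Equiv.Perm α) (x : α) : g⁻¹ (g x) = x :=
  g.symm_apply_apply x


theorem sliceRot_apply {n : ℕ} (a : Fin 3) (c : ℕ) (x : Sticker n) :
    sliceRot n a c x = if cubie x a = c then rot n a x else x := by
  unfold sliceRot
  split_ifs with h
  · rw [Equiv.Perm.ofSubtype_apply_of_mem (p := fun x => cubie x a = c) _ h]
    rfl
  · exact Equiv.Perm.ofSubtype_apply_of_not_mem (p := fun x => cubie x a = c) _ h

theorem cubie_lt {n : ℕ} (x : Sticker n) (b : Fin 3) : cubie x b < n := by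
  obtain ⟨⟨a, s⟩, u, v⟩ := x
  have := u.2
  have := v.2
  unfold cubie
  dsimp only
  split_ifs <;> omega

theorem sliceRot_eq_one {n : ℕ} (a : Fin 3) {c : ℕ} (hc : n ≤ c) : sliceRot n a c = 1 := by
  ext1 x
  have := cubie_lt x a
  rw [sliceRot_apply, if_neg (by omega), Equiv.Perm.one_apply]

theorem sliceRot_mem_G {n : ℕ} (a : Fin 3) {c : ℕ} (hc : 2 * c + 1 ≠ n) :
    sliceRot n a c ∈ G n := by
  rcases lt_or_ge c n with h | h
  · rcases lt_or_ge (2 * c + 1) n with h' | h'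
    · exact Subgroup.subset_closure ⟨(a, false), c + 1, by omega, by omega, by simp [turn]⟩
    · rw [← inv_mem_iff]
      refine Subgroup.subset_closure ⟨(a, true), n - c, by omega, by omega, ?_⟩
      simp only [turn, if_true]
      rw [Nat.sub_sub_self h.le]
  · rw [sliceRot_eq_one a h]
    exact one_mem _

/-- To prove a property of all elements of the cube group, it suffices to treat the quarter turns of
the non-central slices, in one sense of rotation only. -/
theorem G_induction {n : ℕ} {p : Equiv.Perm (Sticker n) → Prop}
    (slice : ∀ a c, 2 * c + 1 ≠ n → p (sliceRot n a c)) (one : p 1)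
    (mul : ∀ g h, g ∈ G n → h ∈ G n → p g → p h → p (g * h))
    (inv : ∀ g, g ∈ G n → p g → p g⁻¹)
    {g : Equiv.Perm (Sticker n)} (hg : g ∈ G n) : p g := by
  induction hg using Subgroup.closure_induction with
  | mem x hx =>
    obtain ⟨f, k, h1, h2, rfl⟩ := hx
    unfold turn
    split_ifs
    · exact inv _ (sliceRot_mem_G _ (by omega)) (slice _ _ (by omega))
    · exact slice _ _ (by omega)
  | one => exact one
  | mul x y hx hy h1 h2 => exact mul x y hx hy h1 h2
  | inv x hx h => exact inv x hx h

theorem cubie_rot_one {n : ℕ} (a : Fin 3) (x : Sticker n) :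
    cubie (rot n a x) (a + 1) = n - 1 - cubie x (a + 2) := by
  obtain ⟨⟨b, s⟩, u, v⟩ := x
  have := u.2
  have := v.2
  fin_cases a <;> fin_cases b <;> cases s <;> simp [cubie, rot, Fin.val_rev] <;> omega

theorem cubie_rot_two {n : ℕ} (a : Fin 3) (x : Sticker n) :
    cubie (rot n a x) (a + 2) = cubie x (a + 1) := by
  obtain ⟨⟨b, s⟩, u, v⟩ := x
  fin_cases a <;> fin_cases b <;> cases s <;> simp [cubie, rot]

theorem axis_cases (a b : Fin 3) : b = a ∨ b = a + 1 ∨ b = a + 2 := by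
  revert a b; decide

theorem axis_cases' (a b : Fin 3) : a = b ∨ a = b + 1 ∨ a = b + 2 := axis_cases b a

theorem funext_axis {α : Type*} {f g : Fin 3 → α} (a : Fin 3) (h0 : f a = g a)
    (h1 : f (a + 1) = g (a + 1)) (h2 : f (a + 2) = g (a + 2)) : f = g := by
  funext b
  rcases axis_cases a b with rfl | rfl | rfl <;> assumption

theorem cubie_rot_congr {n : ℕ} (a : Fin 3) {x y : Sticker n} (h : cubie x = cubie y) :
    cubie (rot n a x) = cubie (rot n a y) := by
  refine funext_axis a ?_ ?_ ?_ <;> simp only [cubie_rot, cubie_rot_one, cubie_rot_two, h]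

theorem cubie_rot_inj {n : ℕ} (a : Fin 3) {x y : Sticker n}
    (h : cubie (rot n a x) = cubie (rot n a y)) : cubie x = cubie y := by
  have h0 := congr_fun h a
  have h1 := congr_fun h (a + 1)
  have h2 := congr_fun h (a + 2)
  rw [cubie_rot, cubie_rot] at h0
  rw [cubie_rot_one, cubie_rot_one] at h1
  rw [cubie_rot_two, cubie_rot_two] at h2
  have := cubie_lt x (a + 2)
  have := cubie_lt y (a + 2)
  exact funext_axis a h0 h2 (by omega)

/-- The cube group moves whole cubies. -/
theorem cubie_eq_iff {n : ℕ} {g : Equiv.Perm (Sticker n)} (hg : g ∈ G n) :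
    ∀ x y, cubie (g x) = cubie (g y) ↔ cubie x = cubie y := by
  refine G_induction (p := fun g => ∀ x y, cubie (g x) = cubie (g y) ↔ cubie x = cubie y)
    ?_ (fun _ _ => Iff.rfl) (fun g h _ _ hg hh x y => ?_) (fun g _ h x y => ?_) hg
  · intro a c _ x y
    rw [sliceRot_apply, sliceRot_apply]
    by_cases hx : cubie x a = c <;> by_cases hy : cubie y a = c
    · rw [if_pos hx, if_pos hy]
      exact ⟨cubie_rot_inj a, cubie_rot_congr a⟩
    · rw [if_pos hx, if_neg hy]
      refine iff_of_false (fun h => hy ?_) (fun h => hy ?_)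
      · rw [← h, cubie_rot, hx]
      · rw [← h, hx]
    · rw [if_neg hx, if_pos hy]
      refine iff_of_false (fun h => hx ?_) (fun h => hx ?_)
      · rw [h, cubie_rot, hy]
      · rw [h, hy]
    · rw [if_neg hx, if_neg hy]
  · rw [Equiv.Perm.mul_apply, Equiv.Perm.mul_apply, hg, hh]
  · rw [← h, perm_apply_inv, perm_apply_inv]

theorem isCenter_apply_iff {n : ℕ} {g : Equiv.Perm (Sticker n)} (hg : g ∈ G n) (x : Sticker n) :
    IsCenter (g x) ↔ IsCenter x := by
  refine ⟨fun h y hy => g.injective (h _ ((cubie_eq_iff hg _ _).2 hy)), fun h y hy => ?_⟩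
  have := h (g⁻¹ y) ((cubie_eq_iff hg _ _).1 (by rwa [perm_apply_inv]))
  rw [← this, perm_apply_inv]

/-! ### Cubies and their stickers -/

theorem cubie_zero {n : ℕ} (x : Sticker n) : cubie x x.1.1 = if x.1.2 then n - 1 else 0 := by
  simp [cubie]

theorem cubie_one {n : ℕ} (x : Sticker n) : cubie x (x.1.1 + 1) = x.2.1 := by
  obtain ⟨⟨a, s⟩, u, v⟩ := x
  fin_cases a <;> simp [cubie]

theorem cubie_two {n : ℕ} (x : Sticker n) : cubie x (x.1.1 + 2) = x.2.2 := by
  obtain ⟨⟨a, s⟩, u, v⟩ := x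
  fin_cases a <;> simp [cubie]

/-- A sticker is determined by its cubie and its face. -/
theorem eq_of_cubie_eq {n : ℕ} {x y : Sticker n} (hc : cubie x = cubie y) (hf : x.1 = y.1) :
    x = y := by
  have h1 := cubie_one x
  have h2 := cubie_two x
  rw [hc, hf, cubie_one] at h1
  rw [hc, hf, cubie_two] at h2
  exact Prod.ext hf (Prod.ext (Fin.ext h1.symm) (Fin.ext h2.symm))

/-- A cubie that touches the face `f` has a sticker on this face. -/
theorem exists_sticker {n : ℕ} (x : Sticker n) (f : Face)
    (h : cubie x f.1 = if f.2 then n - 1 else 0) : ∃ y : Sticker n, y.1 = f ∧ cubie y = cubie x := by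
  refine ⟨(f, ⟨cubie x (f.1 + 1), cubie_lt _ _⟩, ⟨cubie x (f.1 + 2), cubie_lt _ _⟩), rfl, ?_⟩
  refine funext_axis f.1 ?_ ?_ ?_
  · rw [h]; exact cubie_zero _
  · exact cubie_one (n := n) (f, ⟨cubie x (f.1 + 1), cubie_lt _ _⟩, ⟨cubie x (f.1 + 2), cubie_lt _ _⟩)
  · exact cubie_two (n := n) (f, ⟨cubie x (f.1 + 1), cubie_lt _ _⟩, ⟨cubie x (f.1 + 2), cubie_lt _ _⟩)

/-- A sticker is a center sticker if and only if it is not on the rim of its face. -/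
theorem isCenter_iff {n : ℕ} (hn : 2 ≤ n) (x : Sticker n) :
    IsCenter x ↔ ((0 < (x.2.1 : ℕ) ∧ (x.2.1 : ℕ) < n - 1) ∧
      (0 < (x.2.2 : ℕ) ∧ (x.2.2 : ℕ) < n - 1)) := by
  have hl1 := x.2.1.2
  have hl2 := x.2.2.2
  constructor
  · intro hx
    have key : ∀ f : Face, f.1 ≠ x.1.1 → cubie x f.1 ≠ if f.2 then n - 1 else 0 := by
      intro f hf h
      obtain ⟨y, hy, hyx⟩ := exists_sticker x f h
      exact hf (by rw [← hx y hyx, hy])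
    have ne1 : x.1.1 + 1 ≠ x.1.1 := by generalize x.1.1 = a; revert a; decide
    have ne2 : x.1.1 + 2 ≠ x.1.1 := by generalize x.1.1 = a; revert a; decide
    have h1 := key (_, true) ne1
    have h2 := key (_, false) ne1
    have h3 := key (_, true) ne2
    have h4 := key (_, false) ne2
    simp only [cubie_one, cubie_two, if_true, Bool.false_eq_true, if_false] at h1 h2 h3 h4
    omega
  · rintro h y hy
    have hf : y.1 = x.1 := by
      have h0 := cubie_zero y
      have h1 := cubie_zero x
      have hax : y.1.1 = x.1.1 := by
        rcases axis_cases x.1.1 y.1.1 with h' | h' | h'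
        · exact h'
        · rw [hy, h', cubie_one] at h0
          split_ifs at h0 <;> omega
        · rw [hy, h', cubie_two] at h0
          split_ifs at h0 <;> omega
      refine Prod.ext hax ?_
      rw [hy, hax, h1] at h0
      cases hs : x.1.2 <;> cases ht : y.1.2 <;> simp [hs, ht] at h0 ⊢ <;> omega
    exact eq_of_cubie_eq hy hf

/-! ### A model of the rotation orbits -/

/-- The rotation orbit of the sticker place with coordinates `(1, 2)` on the `6 × 6 × 6` cube,
parametrized by the 24 stickers of the `2 × 2 × 2` cube: a sticker of the small cube goes to the
place of the orbit that lies on the same face and in the same quadrant. On this orbit the six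
coordinates `0, …, 5` are all in use, so it is a universal example of a rotation orbit. -/
def base (m : Sticker 2) : Sticker 6 :=
  (m.1, if m.1.2 then
      (if m.2.1 = 0 then (if m.2.2 = 0 then (1, 2) else (2, 4))
        else (if m.2.2 = 0 then (3, 1) else (4, 3)))
    else
      (if m.2.1 = 0 then (if m.2.2 = 0 then (2, 1) else (1, 3))
        else (if m.2.2 = 0 then (4, 2) else (3, 4))))

/-- The coordinates that occur in the rotation orbit of the position `(u, v)`, listed so that the
reversal of `Fin 6` corresponds to the reversal of `Fin n`. -/
def coordVal {n : ℕ} [NeZero n] (u v : Fin n) : Fin 6 → Fin n :=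
  ![0, u, v, v.rev, u.rev, (0 : Fin n).rev]

/-- The map from the stickers of the `6 × 6 × 6` cube to those of the `n × n × n` cube that is
`coordVal u v` on coordinates. -/
def blow {n : ℕ} [NeZero n] (u v : Fin n) (x : Sticker 6) : Sticker n :=
  (x.1, coordVal u v x.2.1, coordVal u v x.2.2)

/-- The rotation orbit of the position `(u, v)`, parametrized by the 24 stickers of the
`2 × 2 × 2` cube, compatibly with all rotations of the cube. It is injective unless `(u, v)` is the
middle of a face. -/
def emb {n : ℕ} [NeZero n] (u v : Fin n) (m : Sticker 2) : Sticker n := blow u v (base m)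

/-- The coordinate on the axis `a` of the place `base m`. -/
def label (a : Fin 3) (m : Sticker 2) : Fin 6 := ⟨cubie (base m) a, cubie_lt _ _⟩

variable {n : ℕ} [NeZero n]

theorem coordVal_rev (u v : Fin n) (l : Fin 6) : coordVal u v l.rev = (coordVal u v l).rev := by
  fin_cases l <;> simp [coordVal]

theorem blow_rot (u v : Fin n) (a : Fin 3) (x : Sticker 6) :
    blow u v (rot 6 a x) = rot n a (blow u v x) := by
  obtain ⟨⟨b, s⟩, i, j⟩ := x
  simp only [blow, rot, Equiv.coe_fn_mk]
  split_ifs <;> simp [coordVal_rev]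

theorem base_rot (a : Fin 3) (m : Sticker 2) : base (rot 2 a m) = rot 6 a (base m) := by
  revert a m
  decide +kernel

theorem emb_rot (u v : Fin n) (a : Fin 3) (m : Sticker 2) :
    emb u v (rot 2 a m) = rot n a (emb u v m) := by
  rw [emb, base_rot, blow_rot, emb]

theorem cubie_blow (u v : Fin n) (x : Sticker 6) (a : Fin 3) :
    cubie (blow u v x) a = coordVal u v ⟨cubie x a, cubie_lt _ _⟩ := by
  rcases axis_cases x.1.1 a with rfl | rfl | rfl
  · have h := cubie_zero (blow u v x)
    have h6 := cubie_zero x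
    obtain ⟨⟨b, s⟩, i, j⟩ := x
    cases s
    · have : (⟨cubie ((b, false), i, j) b, cubie_lt _ _⟩ : Fin 6) = 0 := Fin.ext h6
      exact h.trans (by rw [this]; rfl)
    · have : (⟨cubie ((b, true), i, j) b, cubie_lt _ _⟩ : Fin 6) = 5 := Fin.ext h6
      refine h.trans ?_
      rw [this]
      change n - 1 = ((0 : Fin n).rev : ℕ)
      rw [Fin.val_rev, Fin.val_zero]
  · simp only [cubie_one]
    exact cubie_one (blow u v x)
  · simp only [cubie_two]
    exact cubie_two (blow u v x)

theorem cubie_emb (u v : Fin n) (m : Sticker 2) (a : Fin 3) :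
    cubie (emb u v m) a = coordVal u v (label a m) :=
  cubie_blow u v (base m) a

theorem emb_fst (u v : Fin n) (m : Sticker 2) : (emb u v m).1 = m.1 := rfl

theorem label_rot (a : Fin 3) (m : Sticker 2) : label a (rot 2 a m) = label a m := by
  ext
  simp only [label, base_rot, cubie_rot]

theorem exists_emb (x : Sticker n) : ∃ u v m, emb u v m = x := by
  obtain ⟨⟨a, s⟩, u, v⟩ := x
  cases s
  · exact ⟨v, u, ((a, false), 0, 0), rfl⟩
  · exact ⟨u, v, ((a, true), 0, 0), rfl⟩

/-- The four positions that a rotation orbit has on a face. -/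
theorem emb_same_face (u v : Fin n) {m m' : Sticker 2} (h : m.1 = m'.1) :
    (emb u v m').2 = (emb u v m).2 ∨
    (emb u v m').2 = ((emb u v m).2.2.rev, (emb u v m).2.1) ∨
    (emb u v m').2 = ((emb u v m).2.1.rev, (emb u v m).2.2.rev) ∨
    (emb u v m').2 = ((emb u v m).2.2, (emb u v m).2.1.rev) := by
  obtain ⟨f, i, j⟩ := m
  obtain ⟨f', i', j'⟩ := m'
  obtain rfl : f = f' := h
  obtain ⟨a, s⟩ := f
  cases s <;> fin_cases i <;> fin_cases j <;> fin_cases i' <;> fin_cases j' <;>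
    simp [emb, blow, base, coordVal]

theorem emb_injective {u v : Fin n} (h : ¬ (2 * (u : ℕ) + 1 = n ∧ 2 * (v : ℕ) + 1 = n)) :
    Function.Injective (emb u v) := by
  rintro ⟨⟨a, s⟩, i, j⟩ ⟨⟨b, t⟩, i', j'⟩ he
  have hf : ((a, s) : Face) = (b, t) := by simpa only [emb_fst] using congr_arg Prod.fst he
  obtain ⟨rfl, rfl⟩ := Prod.mk.inj hf
  have hu := u.2
  have hv := v.2
  have h1 : ((emb u v ((a, s), i, j)).2.1 : ℕ) = (emb u v ((a, s), i', j')).2.1 := by rw [he]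
  have h2 : ((emb u v ((a, s), i, j)).2.2 : ℕ) = (emb u v ((a, s), i', j')).2.2 := by rw [he]
  cases s <;> fin_cases i <;> fin_cases j <;> fin_cases i' <;> fin_cases j' <;>
    simp [emb, blow, base, coordVal, Fin.val_rev] at h1 h2 ⊢ <;> omega

/-! ### Action on a rotation orbit and signs -/

/-- On the model orbit, the places with a given coordinate on the axis `a` form one 4-cycle of the
rotation about `a`. -/
theorem exists_fourCycle (a : Fin 3) (l : Fin 6) : ∃ x : Sticker 2,
    x ≠ rot 2 a x ∧ rot 2 a x ≠ rot 2 a (rot 2 a x) ∧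
      rot 2 a (rot 2 a x) ≠ rot 2 a (rot 2 a (rot 2 a x)) ∧
    ∀ m, (Equiv.swap x (rot 2 a x) * Equiv.swap (rot 2 a x) (rot 2 a (rot 2 a x)) *
      Equiv.swap (rot 2 a (rot 2 a x)) (rot 2 a (rot 2 a (rot 2 a x)))) m =
        if label a m = l then rot 2 a m else m := by
  revert a l
  decide +kernel

/-- The quarter turn of all slices of the model orbit whose coordinate is in `S` is a product of one
4-cycle for each element of `S`. -/
theorem exists_model_turn (a : Fin 3) (S : Finset (Fin 6)) : ∃ t : Equiv.Perm (Sticker 2),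
    (∀ m, t m = if label a m ∈ S then rot 2 a m else m) ∧
      Equiv.Perm.sign t = (-1) ^ S.card := by
  have neg3 : (-1 : ℤˣ) * -1 * -1 = -1 := rfl
  induction S using Finset.induction_on with
  | empty => exact ⟨1, by simp, by simp⟩
  | insert l S hl ih =>
    obtain ⟨t, ht, hs⟩ := ih
    obtain ⟨x, h1, h2, h3, hx⟩ := exists_fourCycle a l
    refine ⟨Equiv.swap x (rot 2 a x) * Equiv.swap (rot 2 a x) (rot 2 a (rot 2 a x)) *
      Equiv.swap (rot 2 a (rot 2 a x)) (rot 2 a (rot 2 a (rot 2 a x))) * t, fun m => ?_, ?_⟩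
    rotate_left
    · rw [Finset.card_insert_of_notMem hl, pow_succ', Equiv.Perm.sign_mul, Equiv.Perm.sign_mul,
        Equiv.Perm.sign_mul, Equiv.Perm.sign_swap h1, Equiv.Perm.sign_swap h2,
        Equiv.Perm.sign_swap h3, hs, neg3]
    · rw [Equiv.Perm.mul_apply, hx, ht]
      simp only [Finset.mem_insert]
      by_cases hm : label a m ∈ S
      · have : label a m ≠ l := fun h => hl (h ▸ hm)
        simp [hm, label_rot, this]
      · simp [hm]

theorem exists_slice_model (u v : Fin n) (a : Fin 3) (c : ℕ) : ∃ t : Equiv.Perm (Sticker 2),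
    (∀ m, sliceRot n a c (emb u v m) = emb u v (t m)) ∧
      Equiv.Perm.sign t = (-1) ^ (Finset.univ.filter fun l => (coordVal u v l : ℕ) = c).card := by
  obtain ⟨t, ht, hs⟩ := exists_model_turn a (Finset.univ.filter fun l => (coordVal u v l : ℕ) = c)
  refine ⟨t, fun m => ?_, hs⟩
  rw [sliceRot_apply, ht, cubie_emb]
  simp only [Finset.mem_filter, Finset.mem_univ, true_and]
  split_ifs
  · rw [emb_rot]
  · rfl

theorem card_label (u v : Fin n) (c : ℕ) :
    (Finset.univ.filter fun l => (coordVal u v l : ℕ) = c).card =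
      (if 0 = c then 1 else 0) + (if (u : ℕ) = c then 1 else 0) + (if (v : ℕ) = c then 1 else 0) +
      (if n - (v + 1 : ℕ) = c then 1 else 0) + (if n - (u + 1 : ℕ) = c then 1 else 0) +
      (if n - (0 + 1) = c then 1 else 0) := by
  have h5 : coordVal u v 5 = (0 : Fin n).rev := rfl
  have h4 : coordVal u v 4 = u.rev := rfl
  have h3 : coordVal u v 3 = v.rev := rfl
  have h2 : coordVal u v 2 = v := rfl
  have h1 : coordVal u v 1 = u := rfl
  have h0 : coordVal u v 0 = 0 := rfl
  rw [Finset.card_filter, Fin.sum_univ_six, h0, h1, h2, h3, h4, h5, Fin.val_rev, Fin.val_rev,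
    Fin.val_rev, Fin.val_zero]

/-- The cube group permutes each rotation orbit. Its sign on the orbit of the position `(u, v)` is
determined by its signs on the corners and on the two orbits of edge stickers with the coordinates
`u` and `v`: a quarter turn of the slice `c` has as many 4-cycles on the orbit as `c` occurs among
`0, n - 1, u, n - 1 - u, v, n - 1 - v`. -/
theorem exists_models {g : Equiv.Perm (Sticker n)} (hg : g ∈ G n) (u v : Fin n) :
    ∃ t₀ t₁ t₂ t : Equiv.Perm (Sticker 2),
      (∀ m, g (emb 0 0 m) = emb 0 0 (t₀ m)) ∧ (∀ m, g (emb 0 u m) = emb 0 u (t₁ m)) ∧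
      (∀ m, g (emb 0 v m) = emb 0 v (t₂ m)) ∧ (∀ m, g (emb u v m) = emb u v (t m)) ∧
      Equiv.Perm.sign t₀ * Equiv.Perm.sign t₁ * Equiv.Perm.sign t₂ * Equiv.Perm.sign t = 1 := by
  refine G_induction (p := fun g => ∃ t₀ t₁ t₂ t : Equiv.Perm (Sticker 2),
      (∀ m, g (emb 0 0 m) = emb 0 0 (t₀ m)) ∧ (∀ m, g (emb 0 u m) = emb 0 u (t₁ m)) ∧
      (∀ m, g (emb 0 v m) = emb 0 v (t₂ m)) ∧ (∀ m, g (emb u v m) = emb u v (t m)) ∧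
      Equiv.Perm.sign t₀ * Equiv.Perm.sign t₁ * Equiv.Perm.sign t₂ * Equiv.Perm.sign t = 1)
    ?_ ?_ ?_ ?_ hg
  · intro a c _
    obtain ⟨t₀, h₀, s₀⟩ := exists_slice_model (0 : Fin n) 0 a c
    obtain ⟨t₁, h₁, s₁⟩ := exists_slice_model 0 u a c
    obtain ⟨t₂, h₂, s₂⟩ := exists_slice_model 0 v a c
    obtain ⟨t, h, s⟩ := exists_slice_model u v a c
    refine ⟨t₀, t₁, t₂, t, h₀, h₁, h₂, h, ?_⟩
    rw [s₀, s₁, s₂, s, ← pow_add, ← pow_add, ← pow_add]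
    apply Even.neg_one_pow
    rw [card_label, card_label, card_label, card_label, Fin.val_zero, even_iff_two_dvd]
    omega
  · exact ⟨1, 1, 1, 1, by simp⟩
  · rintro g g' _ _ ⟨t₀, t₁, t₂, t, h₀, h₁, h₂, h, s⟩ ⟨t₀', t₁', t₂', t', h₀', h₁', h₂', h', s'⟩
    refine ⟨t₀ * t₀', t₁ * t₁', t₂ * t₂', t * t', by simp [h₀, h₀'], by simp [h₁, h₁'],
      by simp [h₂, h₂'], by simp [h, h'], ?_⟩
    simp only [Equiv.Perm.sign_mul]
    rw [mul_mul_mul_comm (Equiv.Perm.sign t₀), mul_mul_mul_comm (Equiv.Perm.sign t₀ * _),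
      mul_mul_mul_comm (Equiv.Perm.sign t₀ * _ * _), s, s', one_mul]
  · rintro g _ ⟨t₀, t₁, t₂, t, h₀, h₁, h₂, h, s⟩
    have key : ∀ {e : Sticker 2 → Sticker n} {t : Equiv.Perm (Sticker 2)},
        (∀ m, g (e m) = e (t m)) → ∀ m, g⁻¹ (e m) = e (t⁻¹ m) := by
      intro e t h m
      rw [Equiv.Perm.inv_eq_iff_eq, h, perm_apply_inv]
    refine ⟨t₀⁻¹, t₁⁻¹, t₂⁻¹, t⁻¹, key h₀, key h₁, key h₂, key h, ?_⟩
    simpa only [Equiv.Perm.sign_inv] using s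

/-- An element of the cube group that keeps every sticker on its face fixes all stickers of corners
and edges. -/
theorem apply_eq_of_not_isCenter (hn : 2 ≤ n) {g : Equiv.Perm (Sticker n)} (hg : g ∈ G n)
    (hf : ∀ x, (g x).1 = x.1) {x : Sticker n} (hx : ¬ IsCenter x) : g x = x := by
  -- The other stickers of the cubie of `x` stay on their faces, so extremal coordinates persist.
  have key : ∀ f : Face, (cubie x f.1 = if f.2 then n - 1 else 0) →
      cubie (g x) f.1 = cubie x f.1 := by
    intro f h
    obtain ⟨y, rfl, hyx⟩ := exists_sticker x f h
    rw [h, (cubie_eq_iff hg x y).2 hyx.symm, ← hf y]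
    exact cubie_zero _
  have k1 := key (x.1.1 + 1, true)
  have k2 := key (x.1.1 + 1, false)
  have k3 := key (x.1.1 + 2, true)
  have k4 := key (x.1.1 + 2, false)
  have g1 := cubie_one (g x)
  have g2 := cubie_two (g x)
  rw [hf] at g1 g2
  simp only [cubie_one, cubie_two, g1, g2, if_true, Bool.false_eq_true, if_false] at k1 k2 k3 k4
  rw [isCenter_iff hn] at hx
  have hgf := hf x
  refine Prod.ext hgf ?_
  obtain ⟨u, v, m, rfl⟩ := exists_emb x
  obtain ⟨-, -, -, t, -, -, -, h, -⟩ := exists_models hg u v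
  rw [h] at hgf k1 k2 k3 k4 ⊢
  have h4 := emb_same_face u v (m := m) (m' := t m) hgf.symm
  generalize (emb u v (t m)).2 = y at *
  generalize (emb u v m).2 = z at *
  obtain ⟨p, q⟩ := y
  obtain ⟨p', q'⟩ := z
  have hp := p.2
  have hq := q.2
  have hp' := p'.2
  have hq' := q'.2
  simp only [Prod.mk.injEq, Fin.ext_iff, Fin.val_rev] at h4 k1 k2 k3 k4 hx ⊢
  omega

theorem emb_not_isCenter (hn : 2 ≤ n) (u : Fin n) (m : Sticker 2) : ¬ IsCenter (emb 0 u m) := by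
  rw [isCenter_iff hn]
  obtain ⟨⟨a, s⟩, i, j⟩ := m
  cases s <;> fin_cases i <;> fin_cases j <;> simp [emb, blow, base, coordVal, Fin.val_rev]

/-- An element of the cube group that fixes the corners and the edges is even on every rotation
orbit. -/
theorem sign_eq_one_of_fixes (hn : 2 ≤ n) {g : Equiv.Perm (Sticker n)} (hg : g ∈ G n)
    (hf : ∀ x, ¬ IsCenter x → g x = x) (u v : Fin n) : ∃ t : Equiv.Perm (Sticker 2),
      (∀ m, g (emb u v m) = emb u v (t m)) ∧ Equiv.Perm.sign t = 1 := by
  obtain ⟨t₀, t₁, t₂, t, h₀, h₁, h₂, h, s⟩ := exists_models hg u v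
  refine ⟨t, h, ?_⟩
  have key : ∀ (w : Fin n) (t : Equiv.Perm (Sticker 2)),
      (∀ m, g (emb 0 w m) = emb 0 w (t m)) → t = 1 := by
    intro w t h
    ext1 m
    have := h m
    rw [hf _ (emb_not_isCenter hn w m)] at this
    refine (emb_injective ?_ this).symm
    rw [Fin.val_zero]
    omega
  rw [key 0 t₀ h₀, key u t₁ h₁, key v t₂ h₂] at s
  simpa using s

/-! ### Rotations and slices normalize the cube group -/

theorem rot_rot_one {n : ℕ} (a : Fin 3) (x : Sticker n) :
    rot n a (rot n (a + 1) x) = rot n (a + 2) (rot n a x) := by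
  obtain ⟨⟨b, s⟩, u, v⟩ := x
  fin_cases a <;> fin_cases b <;> simp [rot]

theorem rot_rot_two {n : ℕ} (a : Fin 3) (x : Sticker n) :
    rot n (a + 1) (rot n a (rot n (a + 2) x)) = rot n a x := by
  obtain ⟨⟨b, s⟩, u, v⟩ := x
  fin_cases a <;> fin_cases b <;> simp [rot]

theorem rot_sliceRot {n : ℕ} (a : Fin 3) (c : ℕ) :
    rot n a * sliceRot n a c * (rot n a)⁻¹ = sliceRot n a c := by
  rw [mul_inv_eq_iff_eq_mul]
  ext1 x
  simp only [Equiv.Perm.mul_apply, sliceRot_apply, cubie_rot]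
  split_ifs <;> rfl

theorem rot_sliceRot_one {n : ℕ} (a : Fin 3) (c : ℕ) :
    rot n a * sliceRot n (a + 1) c * (rot n a)⁻¹ = sliceRot n (a + 2) c := by
  rw [mul_inv_eq_iff_eq_mul]
  ext1 x
  simp only [Equiv.Perm.mul_apply, sliceRot_apply, cubie_rot_two]
  split_ifs
  · exact rot_rot_one a x
  · rfl

theorem rot_sliceRot_two {n : ℕ} (a : Fin 3) {c : ℕ} (hc : c < n) :
    rot n a * sliceRot n (a + 2) c * (rot n a)⁻¹ = (sliceRot n (a + 1) (n - 1 - c))⁻¹ := by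
  rw [mul_inv_eq_iff_eq_mul, eq_inv_mul_iff_mul_eq]
  ext1 x
  have := cubie_lt x (a + 2)
  simp only [Equiv.Perm.mul_apply]
  rw [sliceRot_apply (a + 2)]
  split_ifs with h
  · rw [sliceRot_apply, if_pos, rot_rot_two]
    have h' := cubie_rot (n := n) (a + 2) x
    rw [cubie_rot_one, h', h]
  · rw [sliceRot_apply, if_neg]
    rw [cubie_rot_one]
    omega

theorem rot_mem_normalizer {n : ℕ} (a : Fin 3) :
    rot n a ∈ Subgroup.normalizer (G n : Set (Equiv.Perm (Sticker n))) := by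
  refine Subgroup.mem_normalizer_fintype fun g hg => ?_
  refine G_induction (p := fun g => rot n a * g * (rot n a)⁻¹ ∈ G n) ?_ ?_ ?_ ?_ hg
  · intro b c hc
    rcases axis_cases a b with rfl | rfl | rfl
    · rw [rot_sliceRot]
      exact sliceRot_mem_G _ hc
    · rw [rot_sliceRot_one]
      exact sliceRot_mem_G _ hc
    · rcases lt_or_ge c n with h | h
      · rw [rot_sliceRot_two a h]
        exact inv_mem (sliceRot_mem_G _ (by omega))
      · rw [sliceRot_eq_one _ h, mul_one, mul_inv_cancel]
        exact one_mem _
  · rw [mul_one, mul_inv_cancel]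
    exact one_mem _
  · intro g h _ _ hg hh
    rw [← conj_mul]
    exact mul_mem hg hh
  · intro g _ hg
    rw [← conj_inv]
    exact inv_mem hg

theorem exists_turn_slices {n : ℕ} (a : Fin 3) (S : Finset ℕ) (hS : ∀ c ∈ S, 2 * c + 1 ≠ n) :
    ∃ g ∈ G n, ∀ x, g x = if cubie x a ∈ S then rot n a x else x := by
  induction S using Finset.induction_on with
  | empty => exact ⟨1, one_mem _, by simp⟩
  | insert c S hc ih =>
    obtain ⟨g, hg, hx⟩ := ih fun c h => hS c (Finset.mem_insert_of_mem h)
    refine ⟨sliceRot n a c * g, mul_mem (sliceRot_mem_G _ (hS c (Finset.mem_insert_self _ _))) hg,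
      fun x => ?_⟩
    rw [Equiv.Perm.mul_apply, sliceRot_apply, hx]
    simp only [Finset.mem_insert]
    by_cases h : cubie x a ∈ S
    · have : cubie x a ≠ c := fun h' => hc (h' ▸ h)
      simp [h, cubie_rot, this]
    · simp [h]

/-- A quarter turn of the central slice is not in the cube group, but it normalizes it: it is the
rotation of the whole cube followed by the inverse turns of all other slices. -/
theorem sliceRot_mem_normalizer {n : ℕ} (a : Fin 3) (c : ℕ) :
    sliceRot n a c ∈ Subgroup.normalizer (G n : Set (Equiv.Perm (Sticker n))) := by
  by_cases hc : 2 * c + 1 = n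
  · obtain ⟨g, hg, hx⟩ := exists_turn_slices (n := n) a ((Finset.range n).erase c) (by
      intro d hd
      rw [Finset.mem_erase] at hd
      omega)
    have : sliceRot n a c = rot n a * g⁻¹ := by
      rw [eq_mul_inv_iff_mul_eq]
      ext1 x
      have := cubie_lt x a
      rw [Equiv.Perm.mul_apply, hx, sliceRot_apply]
      simp only [Finset.mem_erase, Finset.mem_range, this, and_true]
      by_cases h : cubie x a = c <;> simp [h, cubie_rot]
    rw [this]
    exact mul_mem (rot_mem_normalizer a) (inv_mem (Subgroup.le_normalizer hg))
  · exact Subgroup.le_normalizer (sliceRot_mem_G a hc)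

/-! ### Three-cycles of center stickers -/

/-- If the supports of `f` and `g` meet in a single point `x`, the commutator of `f` and `g` is the
3-cycle `x ↦ f x ↦ g x ↦ x`. -/
theorem commutator_isThreeCycle {α : Type*} [Fintype α] [DecidableEq α] {f g : Equiv.Perm α} {x : α}
    (h : ∀ z, f z ≠ z → g z ≠ z → z = x) (hf : f x ≠ x) (hg : g x ≠ x) :
    (f * g * f⁻¹ * g⁻¹).IsThreeCycle ∧ (f * g * f⁻¹ * g⁻¹) x = f x ∧
      (f * g * f⁻¹ * g⁻¹) (g x) = x := by
  have hfx : f (f x) ≠ f x := fun h' => hf (f.injective h')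
  have hgx : g (g x) ≠ g x := fun h' => hg (g.injective h')
  have hgf : g (f x) = f x := by
    by_contra h'
    exact hf (h _ hfx h')
  have hfg : f (g x) = g x := by
    by_contra h'
    exact hg (h _ h' hgx)
  have hne : g x ≠ f x := fun h' => hfx (by rw [← h', hfg])
  have key : f * g * f⁻¹ * g⁻¹ = Equiv.swap x (g x) * Equiv.swap x (f x) := by
    rw [mul_inv_eq_iff_eq_mul, mul_inv_eq_iff_eq_mul]
    ext1 z
    simp only [Equiv.Perm.mul_apply]
    by_cases h1 : z = x
    · subst h1
      rw [hfg, hgf, Equiv.swap_apply_right, Equiv.swap_apply_left]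
    by_cases h2 : f z = z
    · rw [h2]
      by_cases h3 : g z = z
      · have h4 : z ≠ g x := fun h' => hgx (by rw [← h', h3])
        have h5 : z ≠ f x := fun h' => hfx (by rw [← h', h2])
        rw [h3, h2, Equiv.swap_apply_of_ne_of_ne h1 h5, Equiv.swap_apply_of_ne_of_ne h1 h4]
      · have h3' : g (g z) ≠ g z := fun h' => h3 (g.injective h')
        by_cases h4 : g z = x
        · rw [h4, Equiv.swap_apply_left, Equiv.swap_apply_of_ne_of_ne hf hne.symm]
        · have h6 : f (g z) = g z := by
            by_contra h'
            exact h4 (h _ h' h3')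
          have h7 : g z ≠ f x := fun h' => hfx (by rw [← h', h6])
          have h8 : g z ≠ g x := fun h' => h1 (g.injective h')
          rw [h6, Equiv.swap_apply_of_ne_of_ne h4 h7, Equiv.swap_apply_of_ne_of_ne h4 h8]
    · have h3 : g z = z := by
        by_contra h'
        exact h1 (h _ h2 h')
      have h2' : f (f z) ≠ f z := fun h' => h2 (f.injective h')
      rw [h3]
      by_cases h4 : f z = x
      · rw [h4, Equiv.swap_apply_of_ne_of_ne hg hne, Equiv.swap_apply_right]
      · have h6 : g (f z) = f z := by
          by_contra h'
          exact h4 (h _ h2' h')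
        have h7 : f z ≠ f x := fun h' => h1 (f.injective h')
        have h8 : f z ≠ g x := fun h' => hgx (by rw [← h', h6])
        rw [h6, Equiv.swap_apply_of_ne_of_ne h4 h7, Equiv.swap_apply_of_ne_of_ne h4 h8]
  rw [key]
  refine ⟨Equiv.Perm.isThreeCycle_swap_mul_swap_same hg.symm hf.symm hne, ?_, ?_⟩
  · rw [Equiv.Perm.mul_apply, Equiv.swap_apply_left, Equiv.swap_apply_of_ne_of_ne hf hne.symm]
  · rw [Equiv.Perm.mul_apply, Equiv.swap_apply_of_ne_of_ne hg hne, Equiv.swap_apply_right]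

/-- The only stickers fixed by a rotation are the middle ones of the two faces on its axis. -/
theorem rot_eq_self_iff {n : ℕ} (a : Fin 3) (x : Sticker n) : rot n a x = x ↔
    x.1.1 = a ∧ 2 * cubie x (a + 1) + 1 = n ∧ 2 * cubie x (a + 2) + 1 = n := by
  obtain ⟨⟨b, s⟩, u, v⟩ := x
  have hu := u.2
  have hv := v.2
  by_cases hb : b = a
  · subst hb
    rw [cubie_one (n := n) ((b, s), u, v), cubie_two (n := n) ((b, s), u, v)]
    simp only [rot, Equiv.coe_fn_mk, if_true, Prod.mk.injEq, true_and, Fin.ext_iff, Fin.val_rev]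
    omega
  · refine iff_of_false (fun h => ?_) (fun h => hb h.1)
    have h1 := congr_arg (fun y : Sticker n => y.1.1) h
    revert h1
    simp only [rot, Equiv.coe_fn_mk, if_neg hb]
    clear h
    by_cases h : b = a + 1
    · subst h
      simp only [if_true]
      clear hb
      revert a; decide
    · simp only [if_neg h]
      exact fun h' => h h'.symm

theorem isCenter_of_interior {n : ℕ} (hn : 2 ≤ n) {x : Sticker n} {a e : Fin 3} (hae : a ≠ e)
    (ha : 0 < cubie x a ∧ cubie x a < n - 1) (he : 0 < cubie x e ∧ cubie x e < n - 1) :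
    IsCenter x := by
  have h0 := cubie_zero x
  have h1 := cubie_one x
  have h2 := cubie_two x
  rw [isCenter_iff hn, ← h1, ← h2]
  have key : ∀ b, (0 < cubie x b ∧ cubie x b < n - 1) → b ≠ x.1.1 := by
    rintro b hb rfl
    split_ifs at h0 <;> omega
  have hax := key a ha
  have hex := key e he
  rcases axis_cases x.1.1 a with h | h | h
  · exact absurd h hax
  · rcases axis_cases x.1.1 e with h' | h' | h'
    · exact absurd h' hex
    · exact absurd (h.trans h'.symm) hae
    · exact ⟨h ▸ ha, h' ▸ he⟩
  · rcases axis_cases x.1.1 e with h' | h' | h'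
    · exact absurd h' hex
    · exact ⟨h' ▸ he, h ▸ ha⟩
    · exact absurd (h.trans h'.symm) hae

theorem axis_ne_one (a : Fin 3) : a + 1 ≠ a := by revert a; decide
theorem axis_ne_two (a : Fin 3) : a + 2 ≠ a := by revert a; decide
theorem axis_one_one (a : Fin 3) : a + 1 + 1 = a + 2 := by revert a; decide
theorem axis_one_two (a : Fin 3) : a + 1 + 2 = a := by revert a; decide
theorem axis_two_one (a : Fin 3) : a + 2 + 1 = a := by revert a; decide
theorem axis_two_two (a : Fin 3) : a + 2 + 2 = a + 1 := by revert a; decide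

/-- A cubie is determined by its coordinates on two different axes together with the coordinate that
a rotation about the second axis gives it on the first one. -/
theorem cubie_eq_of_rot {n : ℕ} {a e : Fin 3} (hae : a ≠ e) {x y : Sticker n}
    (ha : cubie x a = cubie y a) (he : cubie x e = cubie y e)
    (hr : cubie (rot n e x) a = cubie (rot n e y) a) : cubie x = cubie y := by
  rcases axis_cases e a with rfl | rfl | rfl
  · exact absurd rfl hae
  · rw [cubie_rot_one, cubie_rot_one] at hr
    have := cubie_lt x (e + 2)
    have := cubie_lt y (e + 2)
    exact funext_axis e he ha (by omega)
  · rw [cubie_rot_two, cubie_rot_two] at hr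
    exact funext_axis e he hr ha

/-- The basic 3-cycle. Let `y` be a center sticker in the inner slice `c` about the axis `a`, and
let a quarter turn `r` of an inner slice about another axis `e` move `y` into the outer layer `c₀`
about `a`. The conjugate by `r` of the turn of the slice `c` meets the turn of the layer `c₀` only
in `r y`, so that their commutator is a 3-cycle. -/
theorem exists_threeCycle_aux {n : ℕ} {a e : Fin 3} (hae : a ≠ e) {y : Sticker n} {c₀ : ℕ}
    (ha : 0 < cubie y a ∧ cubie y a < n - 1) (ha' : 2 * cubie y a + 1 ≠ n)
    (he : 0 < cubie y e ∧ cubie y e < n - 1) (hc : cubie (rot n e y) a = c₀)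
    (hc' : c₀ = 0 ∨ c₀ = n - 1) : ∃ k ∈ G n, k.IsThreeCycle ∧
      k (rot n e y) = sliceRot n e (cubie y e) (rot n a y) ∧
      k (rot n a (rot n e y)) = rot n e y := by
  set r := sliceRot n e (cubie y e) with hr
  set d := sliceRot n a (cubie y a) with hd
  set t := sliceRot n a c₀ with ht
  have hry : r y = rot n e y := by rw [hr, sliceRot_apply, if_pos rfl]
  have hdy : d y = rot n a y := by rw [hd, sliceRot_apply, if_pos rfl]
  have htx : t (rot n e y) = rot n a (rot n e y) := by rw [ht, sliceRot_apply, if_pos hc]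
  have hrd : r⁻¹ (rot n e y) = y := by rw [← hry, perm_inv_apply]
  have hcen : IsCenter y := isCenter_of_interior (by omega) hae ha he
  have hfG : r * d * r⁻¹ ∈ G n :=
    (Subgroup.mem_normalizer_iff.1 (sliceRot_mem_normalizer e _) d).1 (sliceRot_mem_G a ha')
  have htG : t ∈ G n := sliceRot_mem_G a (by omega)
  have hdne : rot n a y ≠ y := by
    intro h
    have h1 := cubie_zero y
    rw [((rot_eq_self_iff a y).1 h).1] at h1
    split_ifs at h1 <;> omega
  have htne : rot n a (rot n e y) ≠ rot n e y := by
    intro h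
    have h1 := ((rot_eq_self_iff a _).1 h).2
    have := cubie_lt y a
    rcases axis_cases' a e with rfl | rfl | rfl
    · exact hae rfl
    · rw [axis_one_one, axis_one_two, cubie_rot_two] at *
      omega
    · rw [axis_two_two, axis_two_one] at *
      rw [cubie_rot_one] at h1
      omega
  obtain ⟨h1, h2, h3⟩ := commutator_isThreeCycle (f := r * d * r⁻¹) (g := t) (x := rot n e y) (by
      intro z hz htz
      simp only [Equiv.Perm.mul_apply] at hz
      obtain ⟨w, rfl⟩ := r.surjective z
      rw [perm_inv_apply] at hz
      have hdw : cubie w a = cubie y a := by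
        by_contra h
        have hw : d w = w := by rw [hd, sliceRot_apply, if_neg h]
        exact hz (by rw [hw])
      have htw : cubie (r w) a = c₀ := by
        by_contra h
        exact htz (by rw [ht, sliceRot_apply, if_neg h])
      by_cases hw : cubie w e = cubie y e
      · rw [hr, sliceRot_apply, if_pos hw] at htw ⊢
        rw [hcen w (cubie_eq_of_rot hae hdw hw (htw.trans hc.symm))]
      · rw [hr, sliceRot_apply, if_neg hw] at htw
        omega)
    (by
      simp only [Equiv.Perm.mul_apply]
      rw [hrd, hdy, ← hry]
      exact fun h => hdne (r.injective h))
    (by rwa [htx])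
  refine ⟨_, mul_mem (mul_mem (mul_mem hfG htG) (inv_mem hfG)) (inv_mem htG), h1, ?_, ?_⟩
  · rw [h2]
    simp only [Equiv.Perm.mul_apply]
    rw [hrd, hdy]
  · rw [← htx]
    exact h3

/-- A center sticker and its image under a quarter turn that moves it lie on a common 3-cycle, which
belongs to the cube group. -/
theorem exists_threeCycle {n : ℕ} (hn : 2 ≤ n) {x : Sticker n} (hx : IsCenter x) {a : Fin 3} {c : ℕ}
    (hc : 2 * c + 1 ≠ n) (hne : sliceRot n a c x ≠ x) :
    ∃ k ∈ G n, k.IsThreeCycle ∧ (k x = sliceRot n a c x ∨ k (sliceRot n a c x) = x) := by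
  have hxa : cubie x a = c := by
    by_contra h
    exact hne (by rw [sliceRot_apply, if_neg h])
  rw [sliceRot_apply, if_pos hxa] at hne ⊢
  have h0 := cubie_zero x
  have h1 := cubie_one x
  have h2 := cubie_two x
  rw [isCenter_iff hn, ← h1, ← h2] at hx
  obtain ⟨hx1, hx2⟩ := hx
  -- If `x` is on the face of the turn, it is moved there from an inner slice; otherwise the turn is
  -- that of an inner slice, and the basic 3-cycle is conjugated back into this slice.
  rcases axis_cases x.1.1 a with rfl | rfl | rfl
  · have hmid : ¬ (2 * cubie x (x.1.1 + 1) + 1 = n ∧ 2 * cubie x (x.1.1 + 2) + 1 = n) :=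
      fun h => hne ((rot_eq_self_iff _ _).2 ⟨rfl, h⟩)
    have hc' : c = 0 ∨ c = n - 1 := by
      rw [← hxa, h0]
      split_ifs <;> simp
    generalize x.1.1 = a at *
    by_cases hq : 2 * cubie x (a + 2) + 1 = n
    · obtain ⟨y, rfl⟩ := (rot n (a + 2)).surjective x
      have e1 := cubie_rot (n := n) (a + 2) y
      have e2 := cubie_rot_two (n := n) (a + 2) y
      rw [axis_two_two, axis_two_one] at e2
      obtain ⟨k, hk, hk3, -, hk'⟩ := exists_threeCycle_aux (axis_ne_two a).symm (y := y)
        (by omega) (by omega) (by omega) hxa hc'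
      exact ⟨k, hk, hk3, Or.inr hk'⟩
    · obtain ⟨y, rfl⟩ := (rot n (a + 1)).surjective x
      have e1 := cubie_rot (n := n) (a + 1) y
      have e2 := cubie_rot_one (n := n) (a + 1) y
      rw [axis_one_one, axis_one_two] at e2
      have := cubie_lt y a
      obtain ⟨k, hk, hk3, -, hk'⟩ := exists_threeCycle_aux (axis_ne_one a).symm (y := y)
        (by omega) (by omega) (by omega) hxa hc'
      exact ⟨k, hk, hk3, Or.inr hk'⟩
  · generalize x.1.1 = b at *
    have e2 := cubie_rot_two (n := n) (b + 2) x
    rw [axis_two_two, axis_two_one] at e2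
    obtain ⟨k, hk, hk3, hk', -⟩ := exists_threeCycle_aux (a := b + 1) (e := b + 2) (by simp) (y := x)
      (by omega) (by omega) (by omega) rfl (by rw [e2, h0]; split_ifs <;> simp)
    refine ⟨_, (Subgroup.mem_normalizer_iff''.1 (sliceRot_mem_normalizer (b + 2)
      (cubie x (b + 2))) k).1 hk, ?_, Or.inl ?_⟩
    · rw [Equiv.Perm.IsThreeCycle, ← hk3]
      nth_rw 2 [← inv_inv (sliceRot n (b + 2) (cubie x (b + 2)))]
      exact Equiv.Perm.cycleType_conj
    · simp only [Equiv.Perm.mul_apply]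
      rw [sliceRot_apply, if_pos rfl, hk', perm_inv_apply]
  · generalize x.1.1 = b at *
    have e2 := cubie_rot_one (n := n) (b + 1) x
    rw [axis_one_one, axis_one_two] at e2
    obtain ⟨k, hk, hk3, hk', -⟩ := exists_threeCycle_aux (a := b + 2) (e := b + 1) (by simp) (y := x)
      (by omega) (by omega) (by omega) rfl (by rw [e2, h0]; split_ifs <;> simp)
    refine ⟨_, (Subgroup.mem_normalizer_iff''.1 (sliceRot_mem_normalizer (b + 1)
      (cubie x (b + 1))) k).1 hk, ?_, Or.inl ?_⟩
    · rw [Equiv.Perm.IsThreeCycle, ← hk3]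
      nth_rw 2 [← inv_inv (sliceRot n (b + 1) (cubie x (b + 1)))]
      exact Equiv.Perm.cycleType_conj
    · simp only [Equiv.Perm.mul_apply]
      rw [sliceRot_apply, if_pos rfl, hk', perm_inv_apply]

/-! ### Transitivity on the orbits of center stickers -/

/-- The quarter turn of the model orbit about the axis `a`, on the places whose coordinate on this
axis is not `2` or `3`. These two stand for the coordinates `v` and `n - 1 - v`, which may be those
of a central slice. -/
def stepModel (a : Fin 3) (m : Sticker 2) : Sticker 2 :=
  if label a m ≠ 2 ∧ label a m ≠ 3 then rot 2 a m else m

/-- The reference place can be taken to any other one by turns about at most three axes in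
succession, the first of which is the axis of its own face. -/
theorem exists_path_model (m : Sticker 2) : ∃ (i j k : Fin 4) (a b : Fin 3),
    (stepModel b)^[k] ((stepModel a)^[j] ((stepModel 0)^[i] ((0, true), 0, 0))) = m := by
  revert m
  decide +kernel

theorem exists_mem_G_step (hn : 2 ≤ n) {u v : Fin n} (hu : 2 * (u : ℕ) + 1 ≠ n) (a : Fin 3)
    (m : Sticker 2) : ∃ g ∈ G n, g (emb u v m) = emb u v (stepModel a m) := by
  unfold stepModel
  split_ifs with h
  · refine ⟨sliceRot n a (cubie (emb u v m) a), sliceRot_mem_G _ ?_, ?_⟩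
    · rw [cubie_emb]
      generalize label a m = l at h
      have := u.2
      fin_cases l <;> simp [coordVal, Fin.val_rev] at h ⊢ <;> omega
    · rw [sliceRot_apply, if_pos rfl, emb_rot]
  · exact ⟨1, one_mem _, rfl⟩

theorem exists_mem_G_iterate (hn : 2 ≤ n) {u v : Fin n} (hu : 2 * (u : ℕ) + 1 ≠ n) (a : Fin 3)
    (i : ℕ) (m : Sticker 2) : ∃ g ∈ G n, g (emb u v m) = emb u v ((stepModel a)^[i] m) := by
  induction i with
  | zero => exact ⟨1, one_mem _, rfl⟩
  | succ i ih =>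
    obtain ⟨g, hg, h⟩ := ih
    obtain ⟨g', hg', h'⟩ := exists_mem_G_step hn hu (v := v) a ((stepModel a)^[i] m)
    refine ⟨g' * g, mul_mem hg' hg, ?_⟩
    rw [Equiv.Perm.mul_apply, h, h', Function.iterate_succ_apply']

/-- The cube group is transitive on the rotation orbit of a position `(u, v)` with `u` not in the
middle. The case that `v` is in the middle is allowed, although slices through `v` are not turned. -/
theorem exists_mem_G_emb (hn : 2 ≤ n) {u : Fin n} (v : Fin n) (hu : 2 * (u : ℕ) + 1 ≠ n)
    (m m' : Sticker 2) : ∃ g ∈ G n, g (emb u v m) = emb u v m' := by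
  have key : ∀ m, ∃ g ∈ G n, g (emb u v ((0, true), 0, 0)) = emb u v m := by
    intro m
    obtain ⟨i, j, k, a, b, rfl⟩ := exists_path_model m
    obtain ⟨g₁, hg₁, h₁⟩ := exists_mem_G_iterate hn hu (v := v) 0 i ((0, true), 0, 0)
    obtain ⟨g₂, hg₂, h₂⟩ := exists_mem_G_iterate hn hu (v := v) a j _
    obtain ⟨g₃, hg₃, h₃⟩ := exists_mem_G_iterate hn hu (v := v) b k _
    exact ⟨g₃ * (g₂ * g₁), mul_mem hg₃ (mul_mem hg₂ hg₁), by
      rw [Equiv.Perm.mul_apply, Equiv.Perm.mul_apply, h₁, h₂, h₃]⟩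
  obtain ⟨g, hg, h⟩ := key m
  obtain ⟨g', hg', h'⟩ := key m'
  exact ⟨g' * g⁻¹, mul_mem hg' (inv_mem hg), by
    rw [Equiv.Perm.mul_apply, ← h, perm_inv_apply, h']⟩

theorem orbit_emb (hn : 2 ≤ n) {u : Fin n} (v : Fin n) (hu : 2 * (u : ℕ) + 1 ≠ n) (m : Sticker 2) :
    MulAction.orbit (G n) (emb u v m) = Set.range (emb u v) := by
  ext x
  constructor
  · rintro ⟨g, rfl⟩
    obtain ⟨-, -, -, t, -, -, -, h, -⟩ := exists_models g.2 u v
    exact ⟨t m, (h m).symm⟩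
  · rintro ⟨m', rfl⟩
    obtain ⟨g, hg, h⟩ := exists_mem_G_emb hn v hu m m'
    exact ⟨⟨g, hg⟩, h⟩

/-! ### All even permutations of a center orbit -/

/-- A nontrivial block contains with a point the whole 3-cycle through it. -/
theorem apply_mem_of_isBlock {α : Type*} [Fintype α] [DecidableEq α]
    {N : Subgroup (Equiv.Perm α)} {B : Set α} (hB : MulAction.IsBlock N B)
    (hB' : ¬ B.Subsingleton) {t : Equiv.Perm α} (ht : t ∈ N) (ht3 : t.IsThreeCycle) {x : α}
    (hx : x ∈ B) : t x ∈ B := by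
  by_contra hxB
  have hdis : ∀ y ∈ B, t y ∉ B := by
    rcases MulAction.isBlock_iff_smul_eq_or_disjoint.1 hB ⟨t, ht⟩ with h | h
    · exact absurd (h ▸ Set.smul_mem_smul_set hx : (⟨t, ht⟩ : N) • x ∈ B) hxB
    · exact fun y hy hy' => Set.disjoint_left.1 h (Set.smul_mem_smul_set hy) hy'
  obtain ⟨y, hy, hxy⟩ : ∃ y ∈ B, y ≠ x := by
    by_contra! h
    exact hB' fun y hy z hz => (h y hy).trans (h z hz).symm
  -- The two points of the block and their two images would be four points moved by the 3-cycle.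
  have hcard := ht3.card_support
  have hmem : ∀ z ∈ B, z ∈ t.support ∧ t z ∈ t.support := by
    intro z hz
    have : z ∈ t.support := Equiv.Perm.mem_support.2 fun h => hdis z hz (h.symm ▸ hz)
    exact ⟨this, Equiv.Perm.apply_mem_support.2 this⟩
  have hsub : ({x, y, t x, t y} : Finset α) ⊆ t.support := by
    intro z hz
    simp only [Finset.mem_insert, Finset.mem_singleton] at hz
    rcases hz with rfl | rfl | rfl | rfl
    exacts [(hmem _ hx).1, (hmem _ hy).1, (hmem _ hx).2, (hmem _ hy).2]
  have h4 : ({x, y, t x, t y} : Finset α).card = 4 := by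
    have e1 : x ≠ t x := fun h => hdis x hx (h ▸ hx)
    have e2 : x ≠ t y := fun h => hdis y hy (h ▸ hx)
    have e3 : y ≠ t x := fun h => hdis x hx (h ▸ hy)
    have e4 : y ≠ t y := fun h => hdis y hy (h ▸ hy)
    have e5 : t x ≠ t y := fun h => hxy (t.injective h).symm
    rw [Finset.card_insert_of_notMem, Finset.card_insert_of_notMem, Finset.card_insert_of_notMem,
      Finset.card_singleton] <;> simp [e1, e2, e3, e4, e5, hxy.symm]
  have := Finset.card_le_card hsub
  omega

/-- The permutations of a rotation orbit that the cube group realizes without moving any other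
sticker. -/
noncomputable def pureSubgroup {u v : Fin n} (h : Function.Injective (emb u v)) :
    Subgroup (Equiv.Perm (Sticker 2)) :=
  (G n).comap (Equiv.Perm.viaEmbeddingHom ⟨emb u v, h⟩)

theorem exists_threeCycle_pure (hn : 2 ≤ n) {u v : Fin n} (h : Function.Injective (emb u v))
    (hcen : ∀ m, IsCenter (emb u v m)) {m m' : Sticker 2} {a : Fin 3} {c : ℕ} (hc : 2 * c + 1 ≠ n)
    (hm : sliceRot n a c (emb u v m) = emb u v m') (hne : m ≠ m') :
    ∃ t ∈ pureSubgroup h, t.IsThreeCycle ∧ t m = m' := by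
  have hne' : emb u v m' ≠ emb u v m := fun h' => hne (h h').symm
  obtain ⟨k, hk, hk3, hkm⟩ := exists_threeCycle hn (hcen m) hc (by rwa [hm])
  rw [hm] at hkm
  wlog hw : k (emb u v m) = emb u v m' generalizing k
  · refine this k⁻¹ (inv_mem hk) hk3.inv ?_ ?_ <;>
    · have := hkm.resolve_left hw
      simp only [← this, perm_inv_apply, true_or]
  obtain ⟨-, -, -, t, -, -, -, ht, -⟩ := exists_models hk u v
  have hpow : ∀ i : ℕ, (k ^ i) (emb u v m) = emb u v ((t ^ i) m) := by
    intro i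
    induction i with
    | zero => rfl
    | succ i ih => rw [pow_succ', pow_succ', Equiv.Perm.mul_apply, ih, ht, Equiv.Perm.mul_apply]
  have hkt : k = Equiv.Perm.viaEmbeddingHom ⟨emb u v, h⟩ t := by
    rw [Equiv.Perm.viaEmbeddingHom_apply]
    ext1 x
    by_cases hx : x ∈ Set.range (emb u v)
    · obtain ⟨m, rfl⟩ := hx
      rw [ht]
      exact (Equiv.Perm.viaEmbedding_apply t ⟨emb u v, h⟩ m).symm
    · rw [Equiv.Perm.viaEmbedding_apply_of_notMem t ⟨emb u v, h⟩ x hx]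
      by_contra hkx
      obtain ⟨i, hi⟩ := (hk3.isCycle.sameCycle (x := emb u v m) (y := x)
        (by rwa [hw]) hkx).exists_nat_pow_eq
      rw [hpow] at hi
      exact hx ⟨_, hi⟩
  refine ⟨t, ?_, ?_, h (by rw [← ht, hw])⟩
  · rw [pureSubgroup, Subgroup.mem_comap, ← hkt]
    exact hk
  · rw [hkt, Equiv.Perm.viaEmbeddingHom_apply, Equiv.Perm.viaEmbedding, Equiv.Perm.IsThreeCycle] at hk3
    rw [Equiv.Perm.IsThreeCycle, ← hk3]
    classical
    convert (Equiv.Perm.cycleType_extendDomain (Equiv.ofInjective (emb u v) h) (g := t)).symm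

/-- The group of pure permutations has the same orbits as the cube group. -/
theorem exists_pure_apply_eq (hn : 2 ≤ n) {u v : Fin n} (h : Function.Injective (emb u v))
    (hcen : ∀ m, IsCenter (emb u v m)) {g : Equiv.Perm (Sticker n)} (hg : g ∈ G n) :
    ∀ m m', g (emb u v m) = emb u v m' → ∃ t ∈ pureSubgroup h, t m = m' := by
  refine G_induction (p := fun g => ∀ m m', g (emb u v m) = emb u v m' →
    ∃ t ∈ pureSubgroup h, t m = m') ?_ ?_ ?_ ?_ hg
  · intro a c hc m m' hm
    by_cases hmm : m = m'
    · exact ⟨1, one_mem _, hmm⟩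
    · obtain ⟨t, ht, -, htm⟩ := exists_threeCycle_pure hn h hcen hc hm hmm
      exact ⟨t, ht, htm⟩
  · exact fun m m' hm => ⟨1, one_mem _, h hm⟩
  · intro g g' _ hg' ih ih' m m' hm
    obtain ⟨-, -, -, t, -, -, -, ht, -⟩ := exists_models hg' u v
    rw [Equiv.Perm.mul_apply, ht] at hm
    obtain ⟨s, hs, e⟩ := ih _ _ hm
    obtain ⟨s', hs', e'⟩ := ih' _ _ (ht m)
    exact ⟨s * s', mul_mem hs hs', by rw [Equiv.Perm.mul_apply, e', e]⟩
  · intro g _ ih m m' hm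
    obtain ⟨s, hs, e⟩ := ih m' m (by rw [← hm, perm_apply_inv])
    exact ⟨s⁻¹, inv_mem hs, by rw [← e, perm_inv_apply]⟩

/-- A nontrivial block of the group of pure permutations is even invariant under the cube group,
because each generator moves each single sticker that it does not fix like some pure 3-cycle. -/
theorem mem_iff_of_isBlock (hn : 2 ≤ n) {u v : Fin n} (h : Function.Injective (emb u v))
    (hcen : ∀ m, IsCenter (emb u v m)) {B : Set (Sticker 2)}
    (hB : MulAction.IsBlock (pureSubgroup h) B) (hB' : ¬ B.Subsingleton)
    {g : Equiv.Perm (Sticker n)} (hg : g ∈ G n) :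
    ∀ m m', g (emb u v m) = emb u v m' → (m ∈ B ↔ m' ∈ B) := by
  refine G_induction (p := fun g => ∀ m m', g (emb u v m) = emb u v m' → (m ∈ B ↔ m' ∈ B))
    ?_ ?_ ?_ ?_ hg
  · intro a c hc m m' hm
    by_cases hmm : m = m'
    · rw [hmm]
    · obtain ⟨t, ht, ht3, rfl⟩ := exists_threeCycle_pure hn h hcen hc hm hmm
      refine ⟨apply_mem_of_isBlock hB hB' ht ht3, fun hm => ?_⟩
      have := apply_mem_of_isBlock hB hB' (inv_mem ht) ht3.inv hm
      rwa [perm_inv_apply] at this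
  · intro m m' hm
    rw [h hm]
  · intro g g' _ hg' ih ih' m m' hm
    obtain ⟨-, -, -, t, -, -, -, ht, -⟩ := exists_models hg' u v
    rw [Equiv.Perm.mul_apply, ht] at hm
    exact (ih' _ _ (ht m)).trans (ih _ _ hm)
  · intro g _ ih m m' hm
    exact (ih m' m (by rw [← hm, perm_apply_inv])).symm

theorem isPreprimitive_pureSubgroup (hn : 2 ≤ n) {u v : Fin n} (h : Function.Injective (emb u v))
    (hcen : ∀ m, IsCenter (emb u v m)) (hu : 2 * (u : ℕ) + 1 ≠ n) :
    MulAction.IsPreprimitive (pureSubgroup h) (Sticker 2) where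
  exists_smul_eq m m' := by
    obtain ⟨g, hg, hm⟩ := exists_mem_G_emb hn v hu m m'
    obtain ⟨t, ht, htm⟩ := exists_pure_apply_eq hn h hcen hg m m' hm
    exact ⟨⟨t, ht⟩, htm⟩
  isTrivialBlock_of_isBlock := by
    intro B hB
    by_cases hB' : B.Subsingleton
    · exact Or.inl hB'
    · refine Or.inr (Set.eq_univ_of_forall fun m' => ?_)
      obtain ⟨m, hm⟩ : B.Nonempty := by
        rw [Set.nonempty_iff_ne_empty]
        rintro rfl
        exact hB' Set.subsingleton_empty
      obtain ⟨g, hg, hgm⟩ := exists_mem_G_emb hn v hu m m'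
      exact (mem_iff_of_isBlock hn h hcen hB hB' hg m m' hgm).1 hm

/-- Every even permutation of an orbit of center stickers that fixes all other stickers belongs to
the cube group. -/
theorem viaEmbedding_mem_G (hn : 2 ≤ n) {u v : Fin n} (h : Function.Injective (emb u v))
    (hcen : ∀ m, IsCenter (emb u v m)) (hu : 2 * (u : ℕ) + 1 ≠ n) {t : Equiv.Perm (Sticker 2)}
    (ht : Equiv.Perm.sign t = 1) : t.viaEmbedding ⟨emb u v, h⟩ ∈ G n := by
  have h0 : cubie (emb u v ((0, true), 0, 0)) 0 = n - 1 := cubie_zero (emb u v ((0, true), 0, 0))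
  obtain ⟨k, hk, hk3, -⟩ := exists_threeCycle_pure hn h hcen (m := ((0, true), 0, 0))
    (m' := rot 2 0 ((0, true), 0, 0)) (a := 0) (c := n - 1) (by omega)
    (by rw [sliceRot_apply, if_pos h0, emb_rot]) (by decide)
  exact Equiv.Perm.alternatingGroup_le_of_isPreprimitive_of_isThreeCycle_mem
    (isPreprimitive_pureSubgroup hn h hcen hu) hk3 hk (Equiv.Perm.mem_alternatingGroup.2 ht)

/-! ### Representatives of the center orbits -/

/-- Indices for the orbits of center stickers, except for the middle stickers of the faces of an odd
cube. The index `(i, j)` stands for the position `(i + 1, j + 1)`. The four rotates of this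
rectangle of positions tile the inner part of a face in the way of a pinwheel, leaving out only the
middle. -/
abbrev CenterIndex (n : ℕ) : Type := Fin (n / 2 - 1) × Fin ((n - 1) / 2)

/-- The first coordinate of the representative of a center orbit; it is never in the middle. -/
def CenterIndex.fst (i : CenterIndex n) : Fin n := ⟨i.1 + 1, by omega⟩

/-- The second coordinate of the representative of a center orbit. -/
def CenterIndex.snd (i : CenterIndex n) : Fin n := ⟨i.2 + 1, by omega⟩

/-- The parametrization of the stickers of the center orbit with index `i`. -/
def embCenter (i : CenterIndex n) (m : Sticker 2) : Sticker n := emb i.fst i.snd m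

theorem fst_ne_middle {n : ℕ} (i : CenterIndex n) : 2 * (i.fst : ℕ) + 1 ≠ n := by
  have := i.1.2
  simp only [CenterIndex.fst]
  omega

theorem embCenter_injective (i : CenterIndex n) : Function.Injective (embCenter i) :=
  emb_injective fun h => fst_ne_middle i h.1

theorem isCenter_embCenter (hn : 2 ≤ n) (i : CenterIndex n) (m : Sticker 2) :
    IsCenter (embCenter i m) := by
  have := i.1.2
  have := i.2.2
  rw [isCenter_iff hn]
  obtain ⟨⟨a, s⟩, j, k⟩ := m
  cases s <;> fin_cases j <;> fin_cases k <;>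
    simp [embCenter, emb, blow, base, coordVal, Fin.val_rev, CenterIndex.fst, CenterIndex.snd] <;>
    omega

theorem eq_of_embCenter_eq {i i' : CenterIndex n} {m m' : Sticker 2}
    (h : embCenter i m = embCenter i' m') : i = i' := by
  obtain ⟨⟨a, s⟩, j, k⟩ := m
  obtain ⟨⟨a', s'⟩, j', k'⟩ := m'
  have hf : ((a, s) : Face) = (a', s') := congr_arg Prod.fst h
  obtain ⟨rfl, rfl⟩ := Prod.mk.inj hf
  have h1 := congr_arg (fun x : Sticker n => (x.2.1 : ℕ)) h
  have h2 := congr_arg (fun x : Sticker n => (x.2.2 : ℕ)) h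
  clear h hf
  obtain ⟨⟨p, hp⟩, ⟨q, hq⟩⟩ := i
  obtain ⟨⟨p', hp'⟩, ⟨q', hq'⟩⟩ := i'
  simp only [Prod.mk.injEq, Fin.mk.injEq]
  cases s <;> fin_cases j <;> fin_cases k <;> fin_cases j' <;> fin_cases k' <;>
    simp [embCenter, emb, blow, base, coordVal, Fin.val_rev, CenterIndex.fst,
      CenterIndex.snd] at h1 h2 <;> omega

/-- Every inner position of a face other than the middle is a rotate of a representative. -/
theorem exists_centerIndex {n : ℕ} {p q : ℕ} (hp : 0 < p ∧ p < n - 1) (hq : 0 < q ∧ q < n - 1)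
    (h : ¬ (2 * p + 1 = n ∧ 2 * q + 1 = n)) : ∃ i : CenterIndex n,
      (p = i.fst ∧ q = i.snd) ∨ (p = n - 1 - i.snd ∧ q = i.fst) ∨
      (p = n - 1 - i.fst ∧ q = n - 1 - i.snd) ∨ (p = i.snd ∧ q = n - 1 - i.fst) := by
  have key : ∀ u v : ℕ, 0 < u → u < n / 2 → 0 < v → v ≤ (n - 1) / 2 →
      ∃ i : CenterIndex n, (i.fst : ℕ) = u ∧ (i.snd : ℕ) = v := fun u v h1 h2 h3 h4 =>
    ⟨(⟨u - 1, by omega⟩, ⟨v - 1, by omega⟩), by simp only [CenterIndex.fst]; omega,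
      by simp only [CenterIndex.snd]; omega⟩
  by_cases h1 : p < n / 2 ∧ q ≤ (n - 1) / 2
  · obtain ⟨i, e1, e2⟩ := key p q (by omega) (by omega) (by omega) (by omega)
    exact ⟨i, by omega⟩
  by_cases h2 : q < n / 2 ∧ n - 1 - p ≤ (n - 1) / 2
  · obtain ⟨i, e1, e2⟩ := key q (n - 1 - p) (by omega) (by omega) (by omega) (by omega)
    exact ⟨i, by omega⟩
  by_cases h3 : n - 1 - p < n / 2 ∧ n - 1 - q ≤ (n - 1) / 2
  · obtain ⟨i, e1, e2⟩ := key (n - 1 - p) (n - 1 - q) (by omega) (by omega) (by omega) (by omega)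
    exact ⟨i, by omega⟩
  · obtain ⟨i, e1, e2⟩ := key (n - 1 - q) p (by omega) (by omega) (by omega) (by omega)
    exact ⟨i, by omega⟩

theorem exists_embCenter (hn : 2 ≤ n) {x : Sticker n} (hx : IsCenter x)
    (h : ¬ (2 * (x.2.1 : ℕ) + 1 = n ∧ 2 * (x.2.2 : ℕ) + 1 = n)) : ∃ i m, embCenter i m = x := by
  obtain ⟨hp, hq⟩ := (isCenter_iff hn x).1 hx
  obtain ⟨⟨a, s⟩, p, q⟩ := x
  dsimp only at hp hq h
  cases s
  -- On a negative face, the frame of the coordinates is left-handed as seen from outside.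
  · obtain ⟨i, hi⟩ := exists_centerIndex hq hp (by omega)
    refine ⟨i, ?_⟩
    rcases hi with hi | hi | hi | hi
    · refine ⟨((a, false), 0, 0), ?_⟩
      simp [embCenter, emb, blow, base, coordVal, Fin.ext_iff]
      omega
    · refine ⟨((a, false), 0, 1), ?_⟩
      simp [embCenter, emb, blow, base, coordVal, Fin.ext_iff, Fin.val_rev]
      omega
    · refine ⟨((a, false), 1, 1), ?_⟩
      simp [embCenter, emb, blow, base, coordVal, Fin.ext_iff, Fin.val_rev]
      omega
    · refine ⟨((a, false), 1, 0), ?_⟩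
      simp [embCenter, emb, blow, base, coordVal, Fin.ext_iff, Fin.val_rev]
      omega
  · obtain ⟨i, hi⟩ := exists_centerIndex hp hq (by omega)
    refine ⟨i, ?_⟩
    rcases hi with hi | hi | hi | hi
    · refine ⟨((a, true), 0, 0), ?_⟩
      simp [embCenter, emb, blow, base, coordVal, Fin.ext_iff]
      omega
    · refine ⟨((a, true), 1, 0), ?_⟩
      simp [embCenter, emb, blow, base, coordVal, Fin.ext_iff, Fin.val_rev]
      omega
    · refine ⟨((a, true), 1, 1), ?_⟩
      simp [embCenter, emb, blow, base, coordVal, Fin.ext_iff, Fin.val_rev]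
      omega
    · refine ⟨((a, true), 0, 1), ?_⟩
      simp [embCenter, emb, blow, base, coordVal, Fin.ext_iff, Fin.val_rev]
      omega

theorem embCenter_ne_middle (i : CenterIndex n) (m : Sticker 2) :
    ¬ (2 * ((embCenter i m).2.1 : ℕ) + 1 = n ∧ 2 * ((embCenter i m).2.2 : ℕ) + 1 = n) := by
  have := i.1.2
  have := i.2.2
  obtain ⟨⟨a, s⟩, j, k⟩ := m
  cases s <;> fin_cases j <;> fin_cases k <;>
    simp [embCenter, emb, blow, base, coordVal, Fin.val_rev, CenterIndex.fst, CenterIndex.snd] <;>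
    omega

/-- The middle stickers of the faces of an odd cube are never moved. -/
theorem orbit_middle {n : ℕ} {x : Sticker n} (h : 2 * (x.2.1 : ℕ) + 1 = n ∧ 2 * (x.2.2 : ℕ) + 1 = n) :
    MulAction.orbit (G n) x = {x} := by
  have key : ∀ g ∈ G n, g x = x := by
    intro g hg
    refine G_induction (p := fun g => g x = x) ?_ rfl ?_ ?_ hg
    · intro a c hc
      rw [sliceRot_apply]
      split_ifs with ha
      · rw [rot_eq_self_iff]
        rcases axis_cases x.1.1 a with rfl | rfl | rfl
        · rw [cubie_one, cubie_two]
          exact ⟨rfl, h⟩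
        · rw [cubie_one] at ha
          omega
        · rw [cubie_two] at ha
          omega
      · rfl
    · intro g g' _ _ hg hg'
      rw [Equiv.Perm.mul_apply, hg', hg]
    · intro g _ hg
      rw [Equiv.Perm.inv_eq_iff_eq, hg]
  ext y
  constructor
  · rintro ⟨g, rfl⟩
    exact key g g.2
  · rintro rfl
    exact MulAction.mem_orbit_self _

theorem orbit_embCenter (hn : 2 ≤ n) (i : CenterIndex n) (m : Sticker 2) :
    MulAction.orbit (G n) (embCenter i m) = Set.range (embCenter i) :=
  orbit_emb hn i.snd (fst_ne_middle i) m

/-! ### Even center permutations -/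

/-- The stickers of all nontrivial center orbits. -/
def embSigma (n : ℕ) [NeZero n] : (Σ _ : CenterIndex n, Sticker 2) ↪ Sticker n where
  toFun x := embCenter x.1 x.2
  inj' := by
    rintro ⟨i, m⟩ ⟨i', m'⟩ h
    obtain rfl : i = i' := eq_of_embCenter_eq h
    obtain rfl : m = m' := embCenter_injective i h
    rfl

/-- The permutation of the stickers that acts on the center orbit with index `i` by `t i`. -/
noncomputable def centerPerm (n : ℕ) [NeZero n] :
    (CenterIndex n → Equiv.Perm (Sticker 2)) →* Equiv.Perm (Sticker n) :=
  (Equiv.Perm.viaEmbeddingHom (embSigma n)).comp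
    (Equiv.Perm.sigmaCongrRightHom fun _ : CenterIndex n => Sticker 2)

theorem centerPerm_apply (t : CenterIndex n → Equiv.Perm (Sticker 2)) (i : CenterIndex n)
    (m : Sticker 2) : centerPerm n t (embCenter i m) = embCenter i (t i m) :=
  Equiv.Perm.viaEmbedding_apply (Equiv.Perm.sigmaCongrRightHom (fun _ => Sticker 2) t)
    (embSigma n) ⟨i, m⟩

theorem centerPerm_apply_of_not_mem (t : CenterIndex n → Equiv.Perm (Sticker 2)) {x : Sticker n}
    (hx : ∀ i m, embCenter i m ≠ x) : centerPerm n t x = x :=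
  Equiv.Perm.viaEmbedding_apply_of_notMem (Equiv.Perm.sigmaCongrRightHom (fun _ => Sticker 2) t)
    (embSigma n) x (by rintro ⟨⟨i, m⟩, h⟩; exact hx i m h)

theorem centerPerm_injective : Function.Injective (centerPerm n) := by
  intro t t' h
  funext i
  ext1 m
  apply embCenter_injective i
  rw [← centerPerm_apply, ← centerPerm_apply, h]

theorem centerPerm_mem_G (hn : 2 ≤ n) {t : CenterIndex n → Equiv.Perm (Sticker 2)}
    (ht : ∀ i, Equiv.Perm.sign (t i) = 1) : centerPerm n t ∈ G n := by
  refine Subgroup.pi_mem_of_mulSingle_mem (H := (G n).comap (centerPerm n)) t fun i => ?_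
  rw [Subgroup.mem_comap]
  convert viaEmbedding_mem_G hn (embCenter_injective i) (isCenter_embCenter hn i) (fst_ne_middle i)
    (ht i) using 1
  ext1 x
  by_cases hx : ∃ i m, embCenter i m = x
  · obtain ⟨j, m, rfl⟩ := hx
    rw [centerPerm_apply]
    by_cases hij : j = i
    · subst hij
      rw [Pi.mulSingle_eq_same]
      exact (Equiv.Perm.viaEmbedding_apply (t j) ⟨embCenter j, embCenter_injective j⟩ m).symm
    · rw [Pi.mulSingle_eq_of_ne hij, Equiv.Perm.one_apply]
      refine (Equiv.Perm.viaEmbedding_apply_of_notMem _ _ _ ?_).symm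
      rintro ⟨m', h⟩
      exact hij (eq_of_embCenter_eq (m := m') (m' := m) h).symm
  · push Not at hx
    rw [centerPerm_apply_of_not_mem _ hx]
    refine (Equiv.Perm.viaEmbedding_apply_of_notMem _ _ _ ?_).symm
    rintro ⟨m', h⟩
    exact hx i m' h

theorem isEvenOn_range_iff {n : ℕ} {e : Sticker 2 → Sticker n} (he : Function.Injective e)
    (g : Equiv.Perm (Sticker n)) : IsEvenOn g (Set.range e) ↔
      ∃ t : Equiv.Perm (Sticker 2), (∀ m, g (e m) = e (t m)) ∧ Equiv.Perm.sign t = 1 := by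
  classical
  have key : ∀ (t : Equiv.Perm (Sticker 2)) (h : ∀ x, g x ∈ Set.range e ↔ x ∈ Set.range e),
      (∀ m, g (e m) = e (t m)) → Equiv.Perm.sign t = Equiv.Perm.sign (g.subtypePerm h) := by
    intro t h ht
    refine Equiv.Perm.sign_eq_sign_of_equiv _ _ (Equiv.ofInjective e he) fun m => ?_
    ext1
    exact (ht m).symm
  constructor
  · rintro ⟨h, hs⟩
    have ht : ∀ m, g (e m) = e ((Equiv.ofInjective e he).symm.permCongr (g.subtypePerm h) m) := by
      intro m
      rw [Equiv.permCongr_apply, Equiv.symm_symm, Equiv.apply_ofInjective_symm he]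
      rfl
    refine ⟨_, ht, (key _ h ht).trans ?_⟩
    convert hs
  · rintro ⟨t, ht, hs⟩
    have h : ∀ x, g x ∈ Set.range e ↔ x ∈ Set.range e := by
      intro x
      constructor
      · rintro ⟨m, hm⟩
        refine ⟨t⁻¹ m, g.injective ?_⟩
        rw [ht, perm_apply_inv, hm]
      · rintro ⟨m, rfl⟩
        exact ⟨t m, (ht m).symm⟩
    refine ⟨h, ?_⟩
    rw [key t h ht] at hs
    convert hs

theorem isEvenOn_singleton {n : ℕ} {g : Equiv.Perm (Sticker n)} {x : Sticker n} (hx : g x = x) :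
    IsEvenOn g {x} := by
  have h : ∀ y, g y ∈ ({x} : Set (Sticker n)) ↔ y ∈ ({x} : Set (Sticker n)) := by
    intro y
    rw [Set.mem_singleton_iff, Set.mem_singleton_iff]
    nth_rw 1 [← hx]
    exact g.injective.eq_iff
  refine ⟨h, ?_⟩
  rw [Subsingleton.elim (g.subtypePerm h) 1]
  exact map_one _

theorem isEvenCenterPerm_iff (hn : 2 ≤ n) (g : Equiv.Perm (Sticker n)) : IsEvenCenterPerm g ↔
    ∃ t : CenterIndex n → Equiv.Perm (Sticker 2),
      centerPerm n t = g ∧ ∀ i, Equiv.Perm.sign (t i) = 1 := by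
  constructor
  · rintro ⟨h1, h2⟩
    have h3 : ∀ i : CenterIndex n, ∃ t : Equiv.Perm (Sticker 2),
        (∀ m, g (embCenter i m) = embCenter i (t m)) ∧ Equiv.Perm.sign t = 1 := by
      intro i
      rw [← isEvenOn_range_iff (embCenter_injective i), ← orbit_embCenter hn i ((0, true), 0, 0)]
      exact h2 _ (isCenter_embCenter hn i _)
    choose t ht hs using h3
    refine ⟨t, ?_, hs⟩
    ext1 x
    by_cases hx : ∃ i m, embCenter i m = x
    · obtain ⟨i, m, rfl⟩ := hx
      rw [centerPerm_apply, ht]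
    · rw [centerPerm_apply_of_not_mem _ fun i m h => hx ⟨i, m, h⟩]
      by_cases hc : IsCenter x
      · have hmid : 2 * (x.2.1 : ℕ) + 1 = n ∧ 2 * (x.2.2 : ℕ) + 1 = n := by
          by_contra h
          exact hx (exists_embCenter hn hc h)
        obtain ⟨h, -⟩ := h2 x hc
        rw [orbit_middle hmid] at h
        exact ((h x).2 rfl).symm
      · exact (h1 x hc).symm
  · rintro ⟨t, rfl, hs⟩
    refine ⟨fun x hx => centerPerm_apply_of_not_mem _ ?_, fun x hx => ?_⟩
    · rintro i m rfl
      exact hx (isCenter_embCenter hn i m)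
    · by_cases hmid : 2 * (x.2.1 : ℕ) + 1 = n ∧ 2 * (x.2.2 : ℕ) + 1 = n
      · have hfix : centerPerm n t x = x := centerPerm_apply_of_not_mem _ (by
          rintro i m rfl
          exact embCenter_ne_middle i m hmid)
        rw [orbit_middle hmid]
        exact isEvenOn_singleton hfix
      · obtain ⟨i, m, rfl⟩ := exists_embCenter hn hx hmid
        rw [orbit_embCenter hn, isEvenOn_range_iff (embCenter_injective i)]
        exact ⟨t i, centerPerm_apply t i, hs i⟩

/-! ### The stabilizer -/

theorem mem_stabilizer_iff {n : ℕ} (s : Sphys n) (g : G n) :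
    g ∈ MulAction.stabilizer (G n) s ↔ ∀ x, s.1 ((g : Equiv.Perm (Sticker n))⁻¹ x) = s.1 x := by
  rw [MulAction.mem_stabilizer_iff, Subtype.ext_iff, funext_iff]
  rfl

/-- Elements of the stabilizer of an appearance are even center permutations. -/
theorem isEvenCenterPerm_of_stabilizer (hn : 2 ≤ n) (s : Sphys n) {g : Equiv.Perm (Sticker n)}
    (hg : g ∈ G n) (hs : ∀ x, s.1 (g⁻¹ x) = s.1 x) : IsEvenCenterPerm g := by
  obtain ⟨c, σ, hσ, rfl⟩ := s
  have hfix : ∀ x, ¬ IsCenter x → g x = x := by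
    intro x hx
    -- In the solved state, the inverse of `g` becomes an element that keeps all faces.
    have h := apply_eq_of_not_isCenter hn (mul_mem (mul_mem (inv_mem hσ) (inv_mem hg)) hσ)
      (x := σ⁻¹ x) (fun y => by
        have := hs (σ y)
        simp only [appearance, perm_inv_apply] at this
        exact this) (by rwa [isCenter_apply_iff (inv_mem hσ)])
    simp only [Equiv.Perm.mul_apply, perm_apply_inv] at h
    rw [← (g⁻¹).injective.eq_iff, perm_inv_apply]
    exact (σ⁻¹.injective h).symm
  refine ⟨hfix, fun x hx => ?_⟩
  by_cases hmid : 2 * (x.2.1 : ℕ) + 1 = n ∧ 2 * (x.2.2 : ℕ) + 1 = n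
  · have hgx : g x = x := by
      have : g x ∈ MulAction.orbit (G n) x := ⟨⟨g, hg⟩, rfl⟩
      rwa [orbit_middle hmid] at this
    rw [orbit_middle hmid]
    exact isEvenOn_singleton hgx
  · obtain ⟨i, m, rfl⟩ := exists_embCenter hn hx hmid
    rw [orbit_embCenter hn, isEvenOn_range_iff (embCenter_injective i)]
    exact sign_eq_one_of_fixes hn hg hfix _ _

/-- A colouring of 24 points with six colours, each used four times, is preserved by `24 ^ 6`
permutations, half of which are even. -/
theorem card_even_stabilizer {c : Sticker 2 → Face}
    (hc : ∀ f, Fintype.card {m // c m = f} = 4) :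
    Nat.card {t : Equiv.Perm (Sticker 2) // Equiv.Perm.sign t = 1 ∧ c ∘ t = c} = 24 ^ 6 / 2 := by
  let K : Subgroup (Equiv.Perm (Sticker 2)) :=
    { carrier := {t | c ∘ t = c}
      one_mem' := rfl
      mul_mem' := by
        intro a b (ha : c ∘ a = c) (hb : c ∘ b = c)
        change (c ∘ a) ∘ b = c
        rw [ha, hb]
      inv_mem' := by
        intro a (ha : c ∘ a = c)
        funext x
        change c (a⁻¹ x) = c x
        conv_rhs => rw [← perm_apply_inv a x]
        exact (congr_fun ha (a⁻¹ x)).symm }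
  let φ : K →* ℤˣ := Equiv.Perm.sign.comp K.subtype
  have hK : Nat.card K = 24 ^ 6 := by
    have h := DomMulAct.stabilizer_card c
    simp only [hc, Finset.prod_const, Finset.card_univ] at h
    rw [← Nat.card_eq_fintype_card] at h
    exact h
  have hφ : Function.Surjective φ := by
    intro z
    rcases Int.units_eq_one_or z with rfl | rfl
    · exact ⟨1, map_one _⟩
    · obtain ⟨⟨x, hx⟩, ⟨y, hy⟩, hxy⟩ := Fintype.one_lt_card_iff.1
        (show 1 < Fintype.card {m // c m = (0, true)} by rw [hc]; norm_num)
      have hxy' : x ≠ y := fun h => hxy (Subtype.ext h)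
      refine ⟨⟨Equiv.swap x y, ?_⟩, Equiv.Perm.sign_swap hxy'⟩
      change c ∘ Equiv.swap x y = c
      funext m
      rw [Function.comp_apply, Equiv.swap_apply_def]
      split_ifs with h h
      · rw [h, hx, hy]
      · rw [h, hx, hy]
      · rfl
  have hker : Nat.card φ.ker * 2 = 24 ^ 6 := by
    have h := Subgroup.card_mul_index φ.ker
    rw [Subgroup.index_ker, MonoidHom.range_eq_top.2 hφ, Subgroup.card_top, hK] at h
    rw [← h, Nat.card_eq_fintype_card (α := ℤˣ)]
    rfl
  have he : Nat.card {t : Equiv.Perm (Sticker 2) // Equiv.Perm.sign t = 1 ∧ c ∘ t = c} =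
      Nat.card φ.ker := Nat.card_congr
    { toFun := fun t => ⟨⟨t.1, t.2.2⟩, t.2.1⟩
      invFun := fun t => ⟨t.1.1, t.2, t.1.2⟩
      left_inv := fun _ => rfl
      right_inv := fun _ => rfl }
  rw [he]
  omega

theorem card_face_model (f : Face) : Fintype.card {m : Sticker 2 // m.1 = f} = 4 := by
  revert f
  decide

/-- On each center orbit, every colour appears four times in every reachable configuration. -/
theorem card_colour (s : Sphys n) (i : CenterIndex n) (f : Face) :
    Fintype.card {m // s.1 (embCenter i m) = f} = 4 := by
  obtain ⟨c, σ, hσ, rfl⟩ := s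
  obtain ⟨-, -, -, t, -, -, -, h, -⟩ := exists_models (inv_mem hσ) i.fst i.snd
  rw [← card_face_model f]
  refine Fintype.card_congr (t.subtypeEquiv fun m => ?_)
  simp only [appearance, embCenter, h, emb_fst]

/-- A center permutation preserves a colouring if and only if it does so on each orbit. -/
theorem centerPerm_preserves_iff (c : Sticker n → Face)
    (t : CenterIndex n → Equiv.Perm (Sticker 2)) :
    (∀ x, c ((centerPerm n t)⁻¹ x) = c x) ↔
      ∀ i, (fun m => c (embCenter i m)) ∘ t i = fun m => c (embCenter i m) := by
  constructor
  · intro h i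
    funext m
    have := h (centerPerm n t (embCenter i m))
    rw [perm_inv_apply, centerPerm_apply] at this
    exact this.symm
  · intro h x
    obtain ⟨y, rfl⟩ := (centerPerm n t).surjective x
    rw [perm_inv_apply]
    by_cases hy : ∃ i m, embCenter i m = y
    · obtain ⟨i, m, rfl⟩ := hy
      rw [centerPerm_apply]
      exact (congr_fun (h i) m).symm
    · rw [centerPerm_apply_of_not_mem _ fun i m h => hy ⟨i, m, h⟩]

theorem stabilizer_map_eq (hn : 2 ≤ n) (s : Sphys n) :
    ((MulAction.stabilizer (G n) s).map (G n).subtype : Set (Equiv.Perm (Sticker n))) =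
      {g | IsEvenCenterPerm g ∧ ∀ x, s.1 (g⁻¹ x) = s.1 x} := by
  ext g
  constructor
  · rintro ⟨g, hg, rfl⟩
    have hg' := (mem_stabilizer_iff s g).1 hg
    exact ⟨isEvenCenterPerm_of_stabilizer hn s g.2 hg', hg'⟩
  · rintro ⟨hg, hs⟩
    obtain ⟨t, rfl, ht⟩ := (isEvenCenterPerm_iff hn g).1 hg
    exact ⟨⟨_, centerPerm_mem_G hn ht⟩, (mem_stabilizer_iff s _).2 hs, rfl⟩

theorem card_stabilizer (hn : 2 ≤ n) (s : Sphys n) :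
    Nat.card (MulAction.stabilizer (G n) s) =
      (24 ^ 6 / 2) ^ ((n / 2 - 1) * ((n - 1) / 2)) := by
  have h : Nat.card (∀ i : CenterIndex n, {t : Equiv.Perm (Sticker 2) //
      Equiv.Perm.sign t = 1 ∧ (fun m => s.1 (embCenter i m)) ∘ t = fun m => s.1 (embCenter i m)}) =
      (24 ^ 6 / 2) ^ ((n / 2 - 1) * ((n - 1) / 2)) := by
    rw [Nat.card_pi, Finset.prod_congr rfl fun i _ => card_even_stabilizer (card_colour s i),
      Finset.prod_const, Finset.card_univ, Fintype.card_prod, Fintype.card_fin, Fintype.card_fin]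
  rw [← h]
  symm
  refine Nat.card_congr (Equiv.ofBijective (fun t => ⟨⟨centerPerm n fun i => (t i).1,
    centerPerm_mem_G hn fun i => (t i).2.1⟩, (mem_stabilizer_iff s _).2
      ((centerPerm_preserves_iff s.1 _).2 fun i => (t i).2.2)⟩) ⟨?_, ?_⟩)
  · intro t t' htt
    have := centerPerm_injective (congr_arg (fun g => (g.1 : Equiv.Perm (Sticker n))) htt)
    funext i
    exact Subtype.ext (congr_fun this i)
  · rintro ⟨⟨g, hg⟩, hs⟩
    have hs' := (mem_stabilizer_iff s _).1 hs
    obtain ⟨t, rfl, ht⟩ :=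
      (isEvenCenterPerm_iff hn g).1 (isEvenCenterPerm_of_stabilizer hn s hg hs')
    exact ⟨fun i => ⟨t i, ht i, (centerPerm_preserves_iff s.1 t).1 hs' i⟩, rfl⟩

end Rubik

theorem mainTheorem5 (n : ℕ) (hn : 2 ≤ n) (s : Rubik.Sphys n) :
    ((MulAction.stabilizer (Rubik.G n) s).map (Rubik.G n).subtype : Set _) =
      {g : Equiv.Perm (Rubik.Sticker n) |
        Rubik.IsEvenCenterPerm g ∧ ∀ x, s.1 (g⁻¹ x) = s.1 x} ∧
    (Odd n → Nat.card (MulAction.stabilizer (Rubik.G n) s) =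
      (24 ^ 6 / 2) ^ ((n - 3) * (n - 1) / 4)) ∧
    (Even n → Nat.card (MulAction.stabilizer (Rubik.G n) s) =
      (24 ^ 6 / 2) ^ ((n - 2) ^ 2 / 4)) := by
  have : NeZero n := ⟨by omega⟩
  refine ⟨Rubik.stabilizer_map_eq hn s, ?_, ?_⟩
  · rintro ⟨k, rfl⟩
    rw [Rubik.card_stabilizer hn s]
    congr 1
    have h1 : (2 * k + 1) / 2 - 1 = k - 1 := by omega
    have h2 : (2 * k + 1 - 1) / 2 = k := by omega
    have h3 : 2 * k + 1 - 3 = 2 * (k - 1) := by omega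
    have h4 : 2 * k + 1 - 1 = 2 * k := by omega
    rw [h1, h2, h3, h4, mul_mul_mul_comm]
    exact (Nat.mul_div_cancel_left _ (by norm_num)).symm
  · rintro ⟨k, rfl⟩
    rw [Rubik.card_stabilizer hn s]
    congr 1
    have h1 : (k + k) / 2 - 1 = k - 1 := by omega
    have h2 : (k + k - 1) / 2 = k - 1 := by omega
    have h3 : k + k - 2 = 2 * (k - 1) := by omega
    rw [h1, h2, h3, mul_pow, sq (k - 1)]
    exact (Nat.mul_div_cancel_left _ (by norm_num)).symm
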